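/- Let $\mathbb D$ be the open unit disc, $\mathbb T$ the unit circle, and let $H(\mathbb D)$ be the space of holomorphic functions on $\mathbb D$ with the topology of uniform convergence on compact subsets of $\mathbb D$. For every compact set $K\subsetneq\mathbb T$ let $\mathcal V(K)$ be a base, consisting of non-empty open sets, of the topology of the space $C(K)$ of continuous functions $K\to\mathbb C$ with the uniform norm (for instance a countable base, or all non-empty open sets). Let $\varrho=(r_n)_{n\ge 0}$ be a sequence in $[0,1)$ with $r_n\to1$. For $r\in[0,1)$ let $\phi_r(z)=rz$, and for $f\in H(\mathbb D)$ and $V\in\mathcal V(K)$ put $$N_f(V,K,\varrho)=\{n\in\mathbb N: (f\circ\phi_{r_n})|_K\in V\},\qquad N_f(V,K)=\{r\in[0,1): (f\circ\phi_r)|_K\in V\}.$$ For $E\subset\mathbb N$ let $$\underline d(E)=\liminf_{n\to\infty}\frac{|E\cap\{1,\dots,n\}|}{n},\qquad \overline d(E)=\limsup_{n\to\infty}\frac{|E\cap\{1,\dots,n\}|}{n},$$ and for $\Gamma\subset[0,1)$ let $$\underline{d_u}(\Gamma)=\liminf_{n\to\infty} n\,|\Gamma\cap[1-1/n,1)|,\qquad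 \overline{d_u}(\Gamma)=1-\underline{d_u}([0,1)\setminus\Gamma),$$ where $|\cdot|$ denotes cardinality for sets of integers and Lebesgue measure for sets of reals. Let $\mathcal{FU}_A(\mathbb D,\varrho)$, $\mathcal{FU}^u_A(\mathbb D,\varrho)$ and $\mathcal{FU}^{u=1}_A(\mathbb D,\varrho)$ be the sets of all $f\in H(\mathbb D)$ such that for every compact $K\subsetneq\mathbb T$ and every $V\in\mathcal V(K)$ one has $\underline d(N_f(V,K,\varrho))>0$, $\overline d(N_f(V,K,\varrho))>0$ and $\overline d(N_f(V,K,\varrho))=1$, respectively. Let $\mathcal{FU}_A(\mathbb D)$, $\mathcal{FU}^u_A(\mathbb D)$ and $\mathcal{FU}^{u=1}_A(\mathbb D)$ be the sets of all $f\in H(\mathbb D)$ such that for every such $K$ and $V$ one has $\underline{d_u}(N_f(V,K))>0$, $\overline{d_u}(N_f(V,K))>0$ and $\overline{d_u}(N_f(V,K))=1$, respectively. Then: 1. $\mathcal{FU}^u_A(\mathbb D,\varrho)$ and $\mathcal{FU}^u_A(\mathbb D)$ are residual in $H(\mathbb D)$; moreover, $\mathcal{FU}^{u=1}_A(\mathbb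 D,\varrho)$ and $\mathcal{FU}^{u=1}_A(\mathbb D)$ are dense $G_\delta$ subsets of $H(\mathbb D)$. 2. $\mathcal{FU}_A(\mathbb D,\varrho)$ and $\mathcal{FU}_A(\mathbb D)$ are of first category in $H(\mathbb D)$; $\mathcal{FU}_A(\mathbb D)$ is dense in $H(\mathbb D)$, and $\mathcal{FU}_A(\mathbb D,\varrho)$ is dense in $H(\mathbb D)$ if the terms $r_n$ are pairwise distinct. -/

import Mathlib

open Set Filter Topology MeasureTheory

namespace AbelUniversal

/-- `H(𝔻)`: the holomorphic functions on the open unit disc, as a subspace of the continuous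
functions on the disc. It carries the induced (compact-open) topology, which is the topology of
uniform convergence on the compact subsets of the disc. -/
def HolDisc : Submodule ℂ C(Metric.ball (0 : ℂ) 1, ℂ) where
  carrier := {f | ∃ F : ℂ → ℂ, DifferentiableOn ℂ F (Metric.ball 0 1) ∧
    ∀ z : Metric.ball (0 : ℂ) 1, F z = f z}
  add_mem' := by
    rintro f g ⟨F, hF, hf⟩ ⟨G, hG, hg⟩
    exact ⟨F + G, hF.add hG, fun z => by simp [hf z, hg z]⟩
  zero_mem' := ⟨0, differentiableOn_const 0, fun z => by simp⟩
  smul_mem' := by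
    rintro c f ⟨F, hF, hf⟩
    exact ⟨c • F, hF.const_smul c, fun z => by simp [hf z]⟩

/-- The map `φ_r : z ↦ r z`, for `0 ≤ r < 1`, from the unit circle to the open unit disc. -/
noncomputable def dilation (r : Ico (0 : ℝ) 1) (z : Circle) : Metric.ball (0 : ℂ) 1 :=
  ⟨(r : ℝ) * (z : ℂ), by
    have h0 : (0 : ℝ) ≤ (r : ℝ) := r.2.1
    have h1 : (r : ℝ) < 1 := r.2.2
    rw [mem_ball_zero_iff, norm_mul, Circle.norm_coe, mul_one, Complex.norm_real,
      Real.norm_of_nonneg h0]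
    exact h1⟩

theorem continuous_dilation (r : Ico (0 : ℝ) 1) : Continuous (dilation r) := by
  unfold dilation
  fun_prop

/-- `f ∘ φ_r`, restricted to a subset `K` of the unit circle, as an element of `C(K)`. -/
noncomputable def radialTrace (f : HolDisc) (r : Ico (0 : ℝ) 1) (K : Set Circle) : C(K, ℂ) where
  toFun z := f.1 (dilation r z)
  continuous_toFun := f.1.continuous.comp ((continuous_dilation r).comp continuous_subtype_val)

/-- `N_f(V, K, ϱ) = {n ∈ ℕ : f ∘ φ_{r_n} ∈ V}`, where `ϱ = (r_n)`. -/
def hitIndices (f : HolDisc) (ϱ : ℕ → Ico (0 : ℝ) 1) (K : Set Circle) (V : Set C(K, ℂ)) : Set ℕ :=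
  {n | radialTrace f (ϱ n) K ∈ V}

/-- `N_f(V, K) = {r ∈ [0, 1) : f ∘ φ_r ∈ V}`, as a set of real numbers. -/
def hitRadii (f : HolDisc) (K : Set Circle) (V : Set C(K, ℂ)) : Set ℝ :=
  {r | ∃ hr : r ∈ Ico (0 : ℝ) 1, radialTrace f ⟨r, hr⟩ K ∈ V}

/-- The lower density of a set of natural numbers. -/
noncomputable def lowerDensity (E : Set ℕ) : ℝ :=
  liminf (fun n : ℕ => ((E ∩ Icc 1 n).ncard : ℝ) / n) atTop

/-- The upper density of a set of natural numbers. -/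
noncomputable def upperDensity (E : Set ℕ) : ℝ :=
  limsup (fun n : ℕ => ((E ∩ Icc 1 n).ncard : ℝ) / n) atTop

/-- The uniform lower density of a set `Γ ⊆ [0, 1)`. -/
noncomputable def uniformLowerDensity (Γ : Set ℝ) : ℝ :=
  liminf (fun n : ℕ => (n : ℝ) * volume.real (Γ ∩ Ico (1 - 1 / (n : ℝ)) 1)) atTop

/-- The uniform upper density of a set `Γ ⊆ [0, 1)`. -/
noncomputable def uniformUpperDensity (Γ : Set ℝ) : ℝ :=
  1 - uniformLowerDensity (Ico 0 1 \ Γ)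

/-- `𝒱` chooses, for every compact proper subset `K` of the unit circle, a family `𝒱 K` of
non-empty open subsets of `C(K)` that is a base of the topology of uniform convergence. -/
def IsBaseChoice (𝒱 : (K : Set Circle) → Set (Set C(K, ℂ))) : Prop :=
  ∀ K : Set Circle, IsCompact K → K ≠ univ →
    TopologicalSpace.IsTopologicalBasis (𝒱 K) ∧ ∅ ∉ 𝒱 K

section Classes

variable (𝒱 : (K : Set Circle) → Set (Set C(K, ℂ))) (ϱ : ℕ → Ico (0 : ℝ) 1)

/-- The `ϱ`-frequently Abel universal functions. -/
def FUAlong : Set HolDisc :=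
  {f | ∀ K : Set Circle, IsCompact K → K ≠ univ → ∀ V ∈ 𝒱 K,
    0 < lowerDensity (hitIndices f ϱ K V)}

/-- The `ϱ`-upper frequently Abel universal functions. -/
def UpperFUAlong : Set HolDisc :=
  {f | ∀ K : Set Circle, IsCompact K → K ≠ univ → ∀ V ∈ 𝒱 K,
    0 < upperDensity (hitIndices f ϱ K V)}

/-- The version of `UpperFUAlong` in which all upper densities are equal to `1`. -/
def UpperOneFUAlong : Set HolDisc :=
  {f | ∀ K : Set Circle, IsCompact K → K ≠ univ → ∀ V ∈ 𝒱 K,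
    upperDensity (hitIndices f ϱ K V) = 1}

/-- The frequently Abel universal functions. -/
def FU : Set HolDisc :=
  {f | ∀ K : Set Circle, IsCompact K → K ≠ univ → ∀ V ∈ 𝒱 K,
    0 < uniformLowerDensity (hitRadii f K V)}

/-- The upper frequently Abel universal functions. -/
def UpperFU : Set HolDisc :=
  {f | ∀ K : Set Circle, IsCompact K → K ≠ univ → ∀ V ∈ 𝒱 K,
    0 < uniformUpperDensity (hitRadii f K V)}

/-- The version of `UpperFU` in which all uniform upper densities are equal to `1`. -/
def UpperOneFU : Set HolDisc :=
  {f | ∀ K : Set Circle, IsCompact K → K ≠ univ → ∀ V ∈ 𝒱 K,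
    uniformUpperDensity (hitRadii f K V) = 1}

end Classes

end AbelUniversal

/-! Every density in the statement is a lower or upper limit of masses μ_n(S), where S is a set of
radii at which f hits V (or misses it), and μ_n is either normalised counting measure on ϱ_1, …, ϱ_n
or normalised Lebesgue measure on [1 - 1/n, 1). Both families have total mass 1 for n ≥ 1 and leave
every [0, t] with t < 1. The residual and meagre parts use little more than this, so the sequential
and continuous cases are treated together.

The analytic input is of Runge type. Since K omits a point of the circle, a disc together with a
sector over K at larger radii has connected complement. Hence a holomorphic function can be changed
slightly on the disc while becoming close to a given polynomial on the sector; iterating gives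
`exists_holomorphic_near_seq`. Countably many pairs (K_p, P_p) test universality (`exists_targets`),
so `dense_classOf` turns density of a class into combinatorics: allot disjoint layers of radii to
the targets so that each target receives a large set.

For upper density one, layers are chosen so thick that some μ_n gives each almost full mass, and
every target gets infinitely many turns. The class is a Gδ because μ_n(near hits) > c is an open
condition on f. A generic f thus hits a ball around 3 with upper density one, which prevents hits of
a disjoint ball around 0 from having positive lower density; hence meagreness. For density of the
lower classes, layers or indices are distributed by 2-adic valuation, each value of which recurs
with bounded gaps. -/

namespace AbelUniversal

/-! ### Polynomial approximation of Runge and Weierstrass type -/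

/-- Pole pushing: if `a` can be joined to infinity outside the compact set `L`, then
`z ↦ (z - a)⁻¹` is a uniform limit of polynomials on `L`. -/
theorem exists_inv_mem_polynomialFunctions_closure {L : Set ℂ} [CompactSpace L] {a : ℂ}
    {A : Set ℂ} (hA : IsPreconnected A) (haA : a ∈ A) (hAL : A ⊆ Lᶜ)
    (hub : ¬ Bornology.IsBounded A) :
    ∃ y ∈ (polynomialFunctions L).topologicalClosure, ∀ z : L, y z * (z - a) = 1 := by
  set S := (polynomialFunctions L).topologicalClosure with hS
  have hcl : IsClosed (S : Set C(L, ℂ)) := Subalgebra.isClosed_topologicalClosure _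
  have hxS : (Polynomial.X : Polynomial ℂ).toContinuousMapOn L ∈ S :=
    Subalgebra.le_topologicalClosure _ ⟨Polynomial.X, trivial, rfl⟩
  let x : S := ⟨_, hxS⟩
  have hspec : spectrum ℂ (x : C(L, ℂ)) = L := by
    rw [ContinuousMap.spectrum_eq_range]
    ext w
    simp [x]
  -- Passing to the closed subalgebra `S` can enlarge the spectrum only by points in bounded
  -- components of the complement of L, and `A` puts a in an unbounded one.
  have ha : a ∉ spectrum ℂ x := by
    intro h
    have h1 := Subalgebra.spectrum_isBounded_connectedComponentIn S x h
    rw [hspec] at h1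
    exact hub (h1.subset (hA.subset_connectedComponentIn haA hAL))
  rw [spectrum.notMem_iff] at ha
  obtain ⟨u, hu⟩ := ha
  refine ⟨-(((u⁻¹ : Sˣ) : S) : C(L, ℂ)), neg_mem (Subtype.property _), fun z => ?_⟩
  have h1 : ((u⁻¹ : Sˣ) : S) * (algebraMap ℂ S a - x) = 1 := by rw [← hu]; simp
  have h2 := congrArg (fun s : S => (s : C(L, ℂ)) z) h1
  have h3 : (((u⁻¹ : Sˣ) : S) : C(L, ℂ)) z * (a - z) = 1 := by simpa [x] using h2
  rw [ContinuousMap.neg_apply]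
  linear_combination h3

theorem exists_polynomial_of_mem_closure {L : Set ℂ} [CompactSpace L] {y : C(L, ℂ)}
    (hy : y ∈ (polynomialFunctions L).topologicalClosure) {ε : ℝ} (hε : 0 < ε) :
    ∃ p : Polynomial ℂ, ∀ z : L, ‖p.eval (z : ℂ) - y z‖ < ε := by
  have h1 : y ∈ closure ((polynomialFunctions L : Subalgebra ℂ C(L, ℂ)) : Set C(L, ℂ)) := hy
  obtain ⟨q, ⟨p, -, rfl⟩, hp⟩ := Metric.mem_closure_iff.1 h1 ε hε
  refine ⟨p, fun z => ?_⟩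
  have := (ContinuousMap.dist_lt_iff hε).1 hp z
  rw [dist_comm, dist_eq_norm] at this
  simpa using this

/-- The part of the ray from `0` through `ζ` outside the open disc of radius `t`. -/
theorem isPreconnected_outer_ray (ζ : Circle) (t : ℝ) :
    IsPreconnected ((fun s : ℝ => (s : ℂ) * ζ) '' Ici t) :=
  isPreconnected_Ici.image _ (by fun_prop)

theorem not_isBounded_outer_ray (ζ : Circle) (t : ℝ) :
    ¬ Bornology.IsBounded ((fun s : ℝ => (s : ℂ) * ζ) '' Ici t) := by
  intro h
  obtain ⟨C, hC⟩ := h.exists_norm_le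
  have := hC _ (mem_image_of_mem _ (mem_Ici.2 (le_max_left t (|C| + 1))))
  simp only [norm_mul, Circle.norm_coe, mul_one, Complex.norm_real, Real.norm_eq_abs] at this
  have h1 := le_abs_self (max t (|C| + 1))
  have h2 := le_max_right t (|C| + 1)
  have h3 := le_abs_self C
  linarith

theorem ofReal_mul_circle_inj {s t : ℝ} {ζ ξ : Circle} (hs : 0 < s) (ht : 0 ≤ t)
    (h : (s : ℂ) * ζ = t * ξ) : ζ = ξ := by
  have h1 : s = t := by
    have := congrArg norm h
    simpa [abs_of_pos hs, abs_of_nonneg ht, Circle.norm_coe] using this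
  subst h1
  have : (s : ℂ) ≠ 0 := by exact_mod_cast hs.ne'
  exact Circle.ext (mul_left_cancel₀ this h)

/-- Weierstrass approximation on a proper compact subset of the circle. -/
theorem exists_polynomial_near {K : Set Circle} (hK : IsCompact K) (hK' : K ≠ univ)
    (g : C(K, ℂ)) {ε : ℝ} (hε : 0 < ε) :
    ∃ p : Polynomial ℂ, ∀ ζ : K, ‖p.eval ((ζ : Circle) : ℂ) - g ζ‖ < ε := by
  obtain ⟨ζ₀, hζ₀⟩ := (ne_univ_iff_exists_notMem K).1 hK'
  set L : Set ℂ := (fun ζ : Circle => (ζ : ℂ)) '' K with hLdef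
  have hL : IsCompact L := hK.image (by fun_prop)
  have : CompactSpace L := isCompact_iff_compactSpace.mp hL
  have : CompactSpace K := isCompact_iff_compactSpace.mp hK
  have hLn : ∀ z : L, ‖(z : ℂ)‖ = 1 := by
    rintro ⟨_, ζ, hζ, rfl⟩
    exact Circle.norm_coe ζ
  obtain ⟨y, hyS, hy⟩ := exists_inv_mem_polynomialFunctions_closure (L := L) (a := 0)
    (isPreconnected_outer_ray ζ₀ 0) ⟨0, by simp⟩ (by
      rintro w ⟨s, hs, rfl⟩ hw
      obtain ⟨ζ, hζ, h⟩ := hw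
      refine hζ₀ ?_
      have : ζ = ζ₀ := ofReal_mul_circle_inj one_pos hs (by simpa using h)
      rwa [← this]) (not_isBounded_outer_ray ζ₀ 0)
  set S := (polynomialFunctions L).topologicalClosure with hS
  -- On the unit circle conjugation is inversion, so pole pushing from 0 places it in the closure of
  -- the polynomials; Stone–Weierstrass then applies.
  have hyX : star ((Polynomial.X : Polynomial ℂ).toContinuousMapOn L) = y := by
    ext z
    have h1 : (starRingEnd ℂ) z * z = 1 := by
      rw [← Complex.normSq_eq_conj_mul_self, Complex.normSq_eq_norm_sq, hLn z]; simp
    have h2 := hy z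
    have hz : (z : ℂ) ≠ 0 := by
      intro h; rw [h] at h1; simp at h1
    apply mul_right_cancel₀ hz
    rw [sub_zero] at h2
    rw [h2]
    simpa using h1
  have hXS : (Polynomial.X : Polynomial ℂ).toContinuousMapOn L ∈ S :=
    Subalgebra.le_topologicalClosure _ ⟨Polynomial.X, trivial, rfl⟩
  have htop : S = ⊤ := by
    have h1 := polynomialFunctions.starClosure_topologicalClosure L
    rw [polynomialFunctions.starClosure_eq_adjoin_X] at h1
    have h2 : (StarAlgebra.adjoin ℂ {(Polynomial.X : Polynomial ℂ).toContinuousMapOn L}).toSubalgebra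
        ≤ S := by
      rw [StarAlgebra.adjoin_toSubalgebra]
      apply Algebra.adjoin_le
      rintro _ (h | h)
      · rw [mem_singleton_iff.1 h]; exact hXS
      · rw [Set.star_singleton, mem_singleton_iff, hyX] at h
        rw [h]; exact hyS
    rw [eq_top_iff]
    intro w _
    have hw : w ∈ (StarAlgebra.adjoin ℂ
        {(Polynomial.X : Polynomial ℂ).toContinuousMapOn L}).topologicalClosure := by
      rw [show StarAlgebra.adjoin ℂ {(Polynomial.X : Polynomial ℂ).toContinuousMapOn L}
        = StarAlgebra.adjoin ℂ {Polynomial.toContinuousMapOnAlgHom L Polynomial.X} from rfl, h1]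
      trivial
    exact closure_minimal h2 (Subalgebra.isClosed_topologicalClosure _) hw
  have hemb : IsEmbedding (fun ζ : Circle => (ζ : ℂ)) := IsEmbedding.subtypeVal
  let e : K ≃ₜ L := hemb.homeomorphImage K
  obtain ⟨p, hp⟩ := exists_polynomial_of_mem_closure
    (show g.comp ⟨e.symm, e.symm.continuous⟩ ∈ S by rw [htop]; trivial) hε
  refine ⟨p, fun ζ => ?_⟩
  have := hp (e ζ)
  change ‖p.eval ((e ζ : L) : ℂ) - g (e.symm (e ζ))‖ < ε at this
  rw [e.symm_apply_apply] at this
  exact this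

/-- A polynomial that is close to `0` on a disc and close to `1` on a sector outside it. -/
theorem exists_polynomial_separator {K : Set Circle} (hK : IsCompact K) (hK' : K ≠ univ)
    {R a b : ℝ} (hR : 0 ≤ R) (hRa : R < a) {ε : ℝ} (hε : 0 < ε) :
    ∃ h : Polynomial ℂ, (∀ z : ℂ, ‖z‖ ≤ R → ‖h.eval z‖ ≤ ε) ∧
      ∀ s ∈ Icc a b, ∀ ζ ∈ K, ‖h.eval ((s : ℂ) * (ζ : ℂ)) - 1‖ ≤ ε := by
  obtain ⟨ζ₀, hζ₀⟩ := (ne_univ_iff_exists_notMem K).1 hK'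
  obtain ⟨ρ, hRρ, hρa⟩ := exists_between hRa
  have hρ : 0 < ρ := hR.trans_lt hRρ
  have ha : 0 < a := hρ.trans hρa
  set sec : Set ℂ := (fun q : ℝ × Circle => (q.1 : ℂ) * (q.2 : ℂ)) '' (Icc a b ×ˢ K) with hsec
  have hsecn : ∀ z ∈ sec, a ≤ ‖z‖ := by
    rintro z ⟨⟨s, ζ⟩, ⟨hs, hζ⟩, rfl⟩
    have h1 : a ≤ s := hs.1
    simpa [Circle.norm_coe, abs_of_pos (ha.trans_le h1)] using h1
  set L : Set ℂ := Metric.closedBall 0 R ∪ sec with hLdef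
  have hL : IsCompact L :=
    (isCompact_closedBall _ _).union ((isCompact_Icc.prod hK).image (by fun_prop))
  have : CompactSpace L := isCompact_iff_compactSpace.mp hL
  -- The circle of radius ρ carries all the poles ωρ used below; the ray through the omitted point
  -- ζ₀ joins it to infinity without meeting the sector.
  set A : Set ℂ := Metric.sphere 0 ρ ∪ (fun s : ℝ => (s : ℂ) * ζ₀) '' Ici ρ with hA
  have hApre : IsPreconnected A := by
    refine IsPreconnected.union ((ρ : ℂ) * ζ₀) ?_ ⟨ρ, self_mem_Ici, rfl⟩
      (isPreconnected_sphere (by rw [Complex.rank_real_complex]; norm_num) _ _)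
      (isPreconnected_outer_ray ζ₀ ρ)
    simp [Circle.norm_coe, hρ.le]
  have hAL : A ⊆ Lᶜ := by
    rintro w (hw | ⟨s, hs, rfl⟩) hwL
    · rw [mem_sphere_zero_iff_norm] at hw
      rcases hwL with h | h
      · rw [mem_closedBall_zero_iff] at h; linarith
      · have := hsecn w h; linarith
    · have hs' : ρ ≤ s := hs
      rcases hwL with h | ⟨⟨t, ζ⟩, ⟨ht, hζ⟩, h⟩
      · rw [mem_closedBall_zero_iff] at h
        simp only [norm_mul, Circle.norm_coe, mul_one, Complex.norm_real, Real.norm_eq_abs] at h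
        have := le_abs_self s
        linarith
      · have h1 : ζ = ζ₀ := ofReal_mul_circle_inj (ha.trans_le ht.1) (hρ.le.trans hs') h
        exact hζ₀ (h1 ▸ hζ)
  have hAub : ¬ Bornology.IsBounded A := fun h =>
    not_isBounded_outer_ray ζ₀ ρ (h.subset subset_union_right)
  -- With this choice δ/(1 - δ) + δ ≤ ε: the first term bounds the rational function's error, the
  -- second that of its polynomial approximant.
  set δ : ℝ := min ε 1 / 4 with hδ
  have hδ0 : 0 < δ := by positivity
  have hδε : δ ≤ ε / 4 := by rw [hδ]; gcongr; exact min_le_left _ _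
  have hδ1 : δ ≤ 1 / 4 := by rw [hδ]; gcongr; exact min_le_right _ _
  obtain ⟨n₁, hn₁⟩ := exists_pow_lt_of_lt_one hδ0 ((div_lt_one hρ).2 hRρ)
  obtain ⟨n₂, hn₂⟩ := exists_pow_lt_of_lt_one hδ0 ((div_lt_one ha).2 hρa)
  set n := n₁ + n₂ + 1 with hn
  have hq₁ : (R / ρ) ^ n ≤ δ := (pow_le_pow_of_le_one (by positivity)
    ((div_lt_one hρ).2 hRρ).le (by omega)).trans hn₁.le
  have hq₂ : (ρ / a) ^ n ≤ δ := (pow_le_pow_of_le_one (by positivity)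
    ((div_lt_one ha).2 hρa).le (by omega)).trans hn₂.le
  have hRn : R ^ n ≤ δ * ρ ^ n := by rwa [div_pow, div_le_iff₀ (by positivity)] at hq₁
  have hρn : ρ ^ n ≤ δ * a ^ n := by rwa [div_pow, div_le_iff₀ (by positivity)] at hq₂
  have hinv : ∀ ω ∈ Polynomial.nthRootsFinset n (1 : ℂ),
      ∃ y ∈ (polynomialFunctions L).topologicalClosure, ∀ z : L, y z * (z - ω * ρ) = 1 := by
    intro ω hω
    rw [Polynomial.mem_nthRootsFinset (by omega)] at hω
    refine exists_inv_mem_polynomialFunctions_closure (L := L) hApre (Or.inl ?_) hAL hAub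
    have : ‖ω‖ = 1 := Complex.norm_eq_one_of_pow_eq_one hω (by omega)
    simp [this, hρ.le]
  choose! y hyS hy using hinv
  -- Y is z^n/(z^n - ρ^n), small for |z| ≤ R < ρ and close to 1 for |z| ≥ a > ρ when n is large.
  set Y : C(L, ℂ) := (Polynomial.X ^ n : Polynomial ℂ).toContinuousMapOn L *
    ∏ ω ∈ Polynomial.nthRootsFinset n (1 : ℂ), y ω with hY
  have hYS : Y ∈ (polynomialFunctions L).topologicalClosure :=
    mul_mem (Subalgebra.le_topologicalClosure _ ⟨Polynomial.X ^ n, trivial, rfl⟩)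
      (prod_mem hyS)
  have hYeq : ∀ z : L, Y z * ((z : ℂ) ^ n - (ρ : ℂ) ^ n) = (z : ℂ) ^ n := by
    intro z
    rw [(Complex.isPrimitiveRoot_exp n (by omega)).pow_sub_pow_eq_prod_sub_mul _ _ (by omega), hY,
      ContinuousMap.mul_apply, ContinuousMap.prod_apply, mul_assoc, ← Finset.prod_mul_distrib,
      Finset.prod_eq_one (fun ω hω => hy ω hω z)]
    simp
  obtain ⟨h, hh⟩ := exists_polynomial_of_mem_closure hYS hδ0
  have hρn0 : 0 < ρ ^ n := by positivity
  refine ⟨h, fun z hz => ?_, fun s hs ζ hζ => ?_⟩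
  · have h1 := hh ⟨z, Or.inl (by simpa using hz)⟩
    have h2 := congrArg norm (hYeq ⟨z, Or.inl (by simpa using hz)⟩)
    set w := Y ⟨z, Or.inl (by simpa using hz)⟩
    simp only [norm_mul, norm_pow] at h2
    have h3 : ‖z‖ ^ n ≤ δ * ρ ^ n := (pow_le_pow_left₀ (norm_nonneg _) hz n).trans hRn
    have h4 : (1 - δ) * ρ ^ n ≤ ‖z ^ n - (ρ : ℂ) ^ n‖ := by
      have := norm_sub_norm_le ((ρ : ℂ) ^ n) (z ^ n)
      rw [norm_sub_rev, norm_pow, norm_pow, Complex.norm_real, Real.norm_of_nonneg hρ.le] at this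
      linarith
    have h5 : ‖w‖ * ((1 - δ) * ρ ^ n) ≤ δ * ρ ^ n :=
      (mul_le_mul_of_nonneg_left h4 (norm_nonneg _)).trans (h2.le.trans h3)
    have h6 : ‖w‖ * (1 - δ) ≤ δ := by
      rw [← mul_assoc] at h5; exact le_of_mul_le_mul_right h5 hρn0
    have h7 : ‖h.eval z‖ ≤ ‖h.eval z - w‖ + ‖w‖ := by
      simpa using norm_add_le (h.eval z - w) w
    have h8 : ‖h.eval z - w‖ < δ := h1
    nlinarith [norm_nonneg w]
  · have hz : (s : ℂ) * ζ ∈ sec := ⟨(s, ζ), ⟨hs, hζ⟩, rfl⟩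
    have hza := hsecn _ hz
    set z := (s : ℂ) * ζ
    have h1 := hh ⟨z, Or.inr hz⟩
    have h2 := hYeq ⟨z, Or.inr hz⟩
    set w := Y ⟨z, Or.inr hz⟩
    have h2' : (w - 1) * (z ^ n - (ρ : ℂ) ^ n) = (ρ : ℂ) ^ n := by
      simp only at h2; linear_combination h2
    have h2'' := congrArg norm h2'
    rw [norm_mul, norm_pow (ρ : ℂ), Complex.norm_real, Real.norm_of_nonneg hρ.le] at h2''
    have han : 0 < a ^ n := by positivity
    have h4 : (1 - δ) * a ^ n ≤ ‖z ^ n - (ρ : ℂ) ^ n‖ := by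
      have := norm_sub_norm_le (z ^ n) ((ρ : ℂ) ^ n)
      rw [norm_pow, norm_pow, Complex.norm_real, Real.norm_of_nonneg hρ.le] at this
      have := pow_le_pow_left₀ ha.le hza n
      linarith
    have h5 : ‖w - 1‖ * ((1 - δ) * a ^ n) ≤ δ * a ^ n :=
      (mul_le_mul_of_nonneg_left h4 (norm_nonneg _)).trans (h2''.le.trans hρn)
    have h6 : ‖w - 1‖ * (1 - δ) ≤ δ := by
      rw [← mul_assoc] at h5; exact le_of_mul_le_mul_right h5 han
    have h7 : ‖h.eval z - 1‖ ≤ ‖h.eval z - w‖ + ‖w - 1‖ := norm_sub_le_norm_sub_add_norm_sub _ _ _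
    have h8 : ‖h.eval z - w‖ < δ := h1
    nlinarith [norm_nonneg (w - 1)]

/-! ### Holomorphic functions prescribed on successive sectors -/

/-- A holomorphic function can be modified so as to be close to a given polynomial on a sector
while hardly changing on a smaller disc. -/
theorem exists_holomorphic_near {K : Set Circle} (hK : IsCompact K) (hK' : K ≠ univ)
    {R a b : ℝ} (hR : 0 ≤ R) (hR1 : R < 1) (hRa : R < a) (hb : b < 1) {ε : ℝ} (hε : 0 < ε)
    (P : Polynomial ℂ) {f : ℂ → ℂ} (hf : DifferentiableOn ℂ f (Metric.ball 0 1)) :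
    ∃ g : ℂ → ℂ, DifferentiableOn ℂ g (Metric.ball 0 1) ∧
      (∀ z : ℂ, ‖z‖ ≤ R → ‖g z - f z‖ ≤ ε) ∧
      ∀ s ∈ Icc a b, ∀ ζ ∈ K, ‖g ((s : ℂ) * (ζ : ℂ)) - P.eval ((s : ℂ) * (ζ : ℂ))‖ ≤ ε := by
  have hsub : Metric.closedBall (0 : ℂ) (max R b) ⊆ Metric.ball 0 1 :=
    Metric.closedBall_subset_ball (max_lt hR1 hb)
  obtain ⟨M, hM⟩ := (isCompact_closedBall (0 : ℂ) (max R b)).exists_bound_of_continuousOn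
    (f := fun z => P.eval z - f z) (P.continuous.continuousOn.sub (hf.continuousOn.mono hsub))
  have hM0 : 0 ≤ M := (norm_nonneg _).trans (hM 0 (by simp [hR]))
  obtain ⟨h, h1, h2⟩ := exists_polynomial_separator (b := b) hK hK' hR hRa
    (ε := ε / (M + 1)) (by positivity)
  have hε' : M * (ε / (M + 1)) ≤ ε := by
    rw [← mul_div_assoc, div_le_iff₀ (by positivity)]; nlinarith
  -- The separating polynomial h switches from f (where h ≈ 0) to P (where h ≈ 1).
  refine ⟨fun z => f z + (P.eval z - f z) * h.eval z,
    hf.add ((P.differentiable.differentiableOn.sub hf).mul h.differentiable.differentiableOn),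
    fun z hz => ?_, fun s hs ζ hζ => ?_⟩
  · rw [add_sub_cancel_left, norm_mul]
    exact (mul_le_mul (hM z (by simp [hz])) (h1 z hz) (norm_nonneg _) hM0).trans hε'
  · set z := (s : ℂ) * (ζ : ℂ)
    have hz : ‖z‖ ≤ b := by
      have : 0 ≤ s := hR.trans (hRa.le.trans hs.1)
      simpa [z, Circle.norm_coe, abs_of_nonneg this] using hs.2
    rw [show f z + (P.eval z - f z) * h.eval z - P.eval z = (P.eval z - f z) * (h.eval z - 1) by
      ring, norm_mul]
    exact (mul_le_mul (hM z (by simp [hz])) (h2 s hs ζ hζ) (norm_nonneg _) hM0).trans hε'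

/-- A holomorphic function close to prescribed polynomials on successive sectors. -/
theorem exists_holomorphic_near_seq {K : ℕ → Set Circle} (hK : ∀ k, IsCompact (K k))
    (hK' : ∀ k, K k ≠ univ) (P : ℕ → Polynomial ℂ) {R : ℝ} (hR : 0 ≤ R) {a b : ℕ → ℝ}
    (hRa : R < a 0) (hab : ∀ k, a k ≤ b k) (hba : ∀ k, b k < a (k + 1)) (hb : ∀ k, b k < 1)
    (hb1 : Tendsto b atTop (𝓝 1)) {ε : ℝ} (hε : 0 < ε) (hε1 : ε ≤ 1)
    {f₀ : ℂ → ℂ} (hf₀ : DifferentiableOn ℂ f₀ (Metric.ball 0 1)) :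
    ∃ f : ℂ → ℂ, DifferentiableOn ℂ f (Metric.ball 0 1) ∧
      (∀ z : ℂ, ‖z‖ ≤ R → ‖f z - f₀ z‖ ≤ ε) ∧
      ∀ k, ∀ s ∈ Icc (a k) (b k), ∀ ζ ∈ K k,
        ‖f ((s : ℂ) * (ζ : ℂ)) - (P k).eval ((s : ℂ) * (ζ : ℂ))‖ ≤ 1 - s := by
  have hmono : Monotone b := monotone_nat_of_le_succ fun k => (hba k).le.trans (hab _)
  -- Stage k must preserve the disc of radius ρ k: R at the start, afterwards the disc containing
  -- all earlier sectors.
  set ρ : ℕ → ℝ := fun k => Nat.casesOn k R b with hρ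
  have hRb : ∀ k, R ≤ b k := fun k => (hRa.le.trans (hab 0)).trans (hmono (Nat.zero_le k))
  have hρa : ∀ k, ρ k < a k := by
    rintro (_ | k)
    exacts [hRa, hba k]
  have hρmono : Monotone ρ := monotone_nat_of_le_succ fun k => (hρa k).le.trans (hab k)
  have hρ1 : ∀ k, ρ k < 1 := fun k => (hρa k).trans_le ((hab k).trans (hb k).le)
  have hρnn : ∀ k, 0 ≤ ρ k := fun k => hR.trans (hρmono (Nat.zero_le k))
  -- The powers of 2 make the corrections summable with total at most ε; the factor 1 - b k keeps
  -- the own error and the later corrections on sector k below (1 - b k)/2 each.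
  set η : ℕ → ℝ := fun k => ε * (1 - b k) / 2 ^ (k + 2) with hη
  have hηpos : ∀ k, 0 < η k := fun k => by
    have := hb k
    have : 0 < 1 - b k := by linarith
    positivity
  have step : ∀ k (g : {g : ℂ → ℂ // DifferentiableOn ℂ g (Metric.ball 0 1)}),
      ∃ g' : {g : ℂ → ℂ // DifferentiableOn ℂ g (Metric.ball 0 1)},
      (∀ z : ℂ, ‖z‖ ≤ ρ k → ‖g'.1 z - g.1 z‖ ≤ η k) ∧
      ∀ s ∈ Icc (a k) (b k), ∀ ζ ∈ K k,
        ‖g'.1 ((s : ℂ) * (ζ : ℂ)) - (P k).eval ((s : ℂ) * (ζ : ℂ))‖ ≤ η k := by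
    intro k g
    obtain ⟨g', h1, h2, h3⟩ := exists_holomorphic_near (hK k) (hK' k) (hρnn k) (hρ1 k) (hρa k)
      (hb k) (hηpos k) (P k) g.2
    exact ⟨⟨g', h1⟩, h2, h3⟩
  choose T hT1 hT2 using step
  let g : ℕ → {g : ℂ → ℂ // DifferentiableOn ℂ g (Metric.ball 0 1)} :=
    fun k => Nat.rec ⟨f₀, hf₀⟩ (fun k g => T k g) k
  have hgs : ∀ k, g (k + 1) = T k (g k) := fun k => rfl
  have hdist : ∀ k (z : ℂ), ‖z‖ ≤ ρ k → ∀ n,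
      dist ((g (n + k)).1 z) ((g (n + 1 + k)).1 z) ≤ (ε * (1 - b k) / 2 ^ (k + 1)) / 2 / 2 ^ n := by
    intro k z hz n
    rw [show n + 1 + k = (n + k) + 1 by ring, hgs, dist_comm, dist_eq_norm]
    refine (hT1 (n + k) _ z (hz.trans (hρmono (by omega)))).trans ?_
    rw [hη, div_div, div_div]
    simp only
    rw [show (2 : ℝ) ^ (n + k + 2) = 2 ^ (k + 1) * 2 * 2 ^ n by ring, ← mul_assoc]
    have : b k ≤ b (n + k) := hmono (by omega)
    gcongr
  have hexk : ∀ z : ℂ, ‖z‖ < 1 → ∃ k, ‖z‖ ≤ ρ k := by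
    intro z hz
    obtain ⟨k, hk⟩ := (hb1.eventually (lt_mem_nhds hz)).exists
    exact ⟨k + 1, hk.le⟩
  have hlim : ∀ z : ℂ, ∃ w, ‖z‖ < 1 → Tendsto (fun n => (g n).1 z) atTop (𝓝 w) := by
    intro z
    by_cases hz : ‖z‖ < 1
    · obtain ⟨k, hk⟩ := hexk z hz
      obtain ⟨w, hw⟩ := cauchySeq_tendsto_of_complete
        (cauchySeq_of_le_geometric_two (hdist k z hk))
      exact ⟨w, fun _ => (tendsto_add_atTop_iff_nat k).1 hw⟩
    · exact ⟨0, fun h => (hz h).elim⟩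
  choose f hf using hlim
  have hnear : ∀ k n (z : ℂ), ‖z‖ ≤ ρ k →
      dist ((g (n + k)).1 z) (f z) ≤ (ε * (1 - b k) / 2 ^ (k + 1)) / 2 ^ n := fun k n z hz =>
    dist_le_of_le_geometric_two_of_tendsto (f := fun n => (g (n + k)).1 z) (hdist k z hz)
      ((tendsto_add_atTop_iff_nat k).2 (hf z (hz.trans_lt (hρ1 k)))) n
  have hnear0 : ∀ k (z : ℂ), ‖z‖ ≤ ρ k →
      ‖f z - (g k).1 z‖ ≤ ε * (1 - b k) / 2 ^ (k + 1) := by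
    intro k z hz
    have := hnear k 0 z hz
    rwa [zero_add, pow_zero, div_one, dist_comm, dist_eq_norm] at this
  refine ⟨f, ?_, fun z hz => ?_, fun k s hs ζ hζ => ?_⟩
  · have hloc : TendstoLocallyUniformlyOn (fun n => (g n).1) f atTop (Metric.ball 0 1) := by
      rw [tendstoLocallyUniformlyOn_iff_forall_isCompact Metric.isOpen_ball]
      intro C hCs hC
      obtain ⟨k, hk⟩ : ∃ k, ∀ z ∈ C, ‖z‖ ≤ ρ k := by
        rcases C.eq_empty_or_nonempty with rfl | hne
        · exact ⟨0, by simp⟩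
        · obtain ⟨z₀, hz₀, hmax⟩ := hC.exists_isMaxOn hne continuous_norm.continuousOn
          obtain ⟨k, hk⟩ := hexk z₀ (by simpa using hCs hz₀)
          exact ⟨k, fun z hz => (hmax hz).trans hk⟩
      rw [Metric.tendstoUniformlyOn_iff]
      intro δ hδ
      have h1 : Tendsto (fun n : ℕ => (ε * (1 - b k) / 2 ^ (k + 1)) / 2 ^ n) atTop (𝓝 0) :=
        tendsto_const_nhds.div_atTop (tendsto_pow_atTop_atTop_of_one_lt one_lt_two)
      obtain ⟨N, hN⟩ := (h1.eventually (gt_mem_nhds hδ)).exists_forall_of_atTop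
      filter_upwards [eventually_ge_atTop (N + k)] with n hn z hz
      have h2 := hnear k (n - k) z (hk z hz)
      rw [Nat.sub_add_cancel (by omega)] at h2
      rw [dist_comm]
      exact h2.trans_lt (hN _ (by omega))
    exact hloc.differentiableOn (Eventually.of_forall fun n => (g n).2) Metric.isOpen_ball
  · refine (hnear0 0 z hz).trans ?_
    have h0 : 0 ≤ b 0 := hR.trans (hRb 0)
    have h1 := hb 0
    have h2 : ε * (1 - b 0) ≤ ε * 1 := by gcongr; linarith
    norm_num
    linarith
  · have hs0 : 0 ≤ s := hR.trans ((hρmono (Nat.zero_le k)).trans ((hρa k).le.trans hs.1))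
    set z := (s : ℂ) * (ζ : ℂ)
    have hz : ‖z‖ ≤ ρ (k + 1) := by
      simpa [z, Circle.norm_coe, abs_of_nonneg hs0] using hs.2
    have h1 := hnear0 (k + 1) z hz
    have h2 : ‖(g (k + 1)).1 z - (P k).eval z‖ ≤ η k := hT2 k (g k) s hs ζ hζ
    have h3 := norm_sub_le_norm_sub_add_norm_sub (f z) ((g (k + 1)).1 z) ((P k).eval z)
    have h4 : b k ≤ b (k + 1) := hmono (by omega)
    have h5 : ε * (1 - b (k + 1)) / 2 ^ (k + 1 + 1) ≤ (1 - b k) / 2 := by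
      have h6 : (0 : ℝ) ≤ 1 - b (k + 1) := by linarith [hb (k + 1)]
      have h7 : (2 : ℝ) ≤ 2 ^ (k + 1 + 1) := by
        calc (2 : ℝ) = 2 ^ 1 := by norm_num
          _ ≤ _ := pow_le_pow_right₀ one_le_two (by omega)
      have h8 : ε * (1 - b (k + 1)) ≤ 1 - b k := by nlinarith
      have h9 : (0 : ℝ) ≤ 1 - b k := by linarith
      calc _ ≤ (1 - b k) / 2 ^ (k + 1 + 1) := by gcongr
        _ ≤ _ := by gcongr
    have h6 : η k ≤ (1 - b k) / 2 := by
      have h7 : (2 : ℝ) ≤ 2 ^ (k + 2) := by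
        calc (2 : ℝ) = 2 ^ 1 := by norm_num
          _ ≤ _ := pow_le_pow_right₀ one_le_two (by omega)
      have h9 : (0 : ℝ) ≤ 1 - b k := by linarith [hb k]
      have h8 : ε * (1 - b k) ≤ 1 - b k := by nlinarith
      calc _ ≤ (1 - b k) / 2 ^ (k + 2) := div_le_div_of_nonneg_right h8 (by positivity)
        _ ≤ _ := by gcongr
    have := hs.2
    linarith

/-! ### Hit sets and reduction to countably many targets -/

/-- The radii at which the trace of `f` on `K` lies in `V`. -/
def hits (f : HolDisc) (K : Set Circle) (V : Set C(K, ℂ)) : Set (Ico (0 : ℝ) 1) :=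
  {r | radialTrace f r K ∈ V}

/-- The functions all of whose hit sets are large in the sense of `Q`. -/
def classOf (𝒱 : (K : Set Circle) → Set (Set C(K, ℂ))) (Q : Set (Ico (0 : ℝ) 1) → Prop) :
    Set HolDisc :=
  {f | ∀ K : Set Circle, IsCompact K → K ≠ univ → ∀ V ∈ 𝒱 K, Q (hits f K V)}

/-- The restriction of a polynomial to a subset of the circle. -/
noncomputable def polyTrace (P : Polynomial ℂ) (K : Set Circle) : C(K, ℂ) where
  toFun ζ := P.eval ((ζ : Circle) : ℂ)
  continuous_toFun := by fun_prop

/-- The radii at which the trace of `f` on `K` is uniformly close to the polynomial `P`. -/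
def near (f : HolDisc) (K : Set Circle) (P : Polynomial ℂ) (δ : ℝ) : Set (Ico (0 : ℝ) 1) :=
  {r | ∀ ζ ∈ K, ‖f.1 (dilation r ζ) - P.eval (ζ : ℂ)‖ < δ}

theorem polyTrace_tube {K : Set Circle} (hK : IsCompact K) (P : Polynomial ℂ) {δ : ℝ}
    (hδ : 0 < δ) : IsOpen {g : C(K, ℂ) | ∀ ζ : K, ‖g ζ - P.eval ((ζ : Circle) : ℂ)‖ < δ} := by
  have : CompactSpace K := isCompact_iff_compactSpace.mp hK
  suffices h : {g : C(K, ℂ) | ∀ ζ : K, ‖g ζ - P.eval ((ζ : Circle) : ℂ)‖ < δ} =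
      Metric.ball (polyTrace P K) δ by
    rw [h]; exact Metric.isOpen_ball
  ext g
  rw [Metric.mem_ball, ContinuousMap.dist_lt_iff hδ]
  simp only [dist_eq_norm]
  rfl

theorem exists_tube_subset {K : Set Circle} (hK : IsCompact K) {P : Polynomial ℂ}
    {V : Set C(K, ℂ)} (hV : IsOpen V) (hP : polyTrace P K ∈ V) :
    ∃ δ > 0, ∀ f : HolDisc, near f K P δ ⊆ hits f K V := by
  have : CompactSpace K := isCompact_iff_compactSpace.mp hK
  obtain ⟨δ, hδ, h⟩ := Metric.isOpen_iff.1 hV _ hP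
  refine ⟨δ, hδ, fun f r hr => h ?_⟩
  rw [Metric.mem_ball, ContinuousMap.dist_lt_iff hδ]
  intro ζ
  rw [dist_eq_norm]
  exact hr ζ ζ.2

theorem exists_dense_polynomials {K : Set Circle} (hK : IsCompact K) (hK' : K ≠ univ) :
    ∃ P : ℕ → Polynomial ℂ, DenseRange fun n => polyTrace (P n) K := by
  have : CompactSpace K := isCompact_iff_compactSpace.mp hK
  have hd : Dense (range fun P => polyTrace P K) := by
    intro g
    rw [Metric.mem_closure_iff]
    intro ε hε
    obtain ⟨p, hp⟩ := exists_polynomial_near hK hK' g hε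
    refine ⟨_, ⟨p, rfl⟩, ?_⟩
    rw [dist_comm, ContinuousMap.dist_lt_iff hε]
    intro ζ
    rw [dist_eq_norm]
    exact hp ζ
  obtain ⟨t, ht, htc, htd⟩ := hd.exists_countable_dense_subset
  obtain ⟨g, rfl⟩ := htc.exists_eq_range htd.nonempty
  choose P hP using fun n => ht (mem_range_self n)
  exact ⟨P, by
    have : (fun n => polyTrace (P n) K) = g := funext hP
    rw [this]; exact htd⟩

/-- Countably many proper compact sets and polynomials suffice to test universality. -/
theorem exists_targets : ∃ (K : ℕ → Set Circle) (P : ℕ → Polynomial ℂ),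
    (∀ p, IsCompact (K p)) ∧ (∀ p, K p ≠ univ) ∧
    ∀ K' : Set Circle, IsCompact K' → K' ≠ univ → ∀ V : Set C(K', ℂ), IsOpen V → V.Nonempty →
      ∃ p, K' ⊆ K p ∧ polyTrace (P p) K' ∈ V := by
  let x : ℕ → Circle := TopologicalSpace.denseSeq Circle
  -- A proper closed subset of the circle misses some ball, hence a smaller one with centre in the
  -- dense sequence and radius 1/(l + 1); so it lies in some C i.
  let C : ℕ × ℕ → Set Circle := fun i => (Metric.ball (x i.1) (1 / ((i.2 : ℝ) + 1)))ᶜ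
  have hC : ∀ i, IsCompact (C i) := fun i => Metric.isOpen_ball.isClosed_compl.isCompact
  have hxC : ∀ i, x i.1 ∉ C i := fun i h => h (Metric.mem_ball_self (by positivity))
  have hC' : ∀ i, C i ≠ univ := fun i h => hxC i (h ▸ mem_univ _)
  choose P hP using fun i => exists_dense_polynomials (hC i) (hC' i)
  obtain ⟨e, he⟩ := exists_surjective_nat ((ℕ × ℕ) × ℕ)
  refine ⟨fun p => C (e p).1, fun p => P (e p).1 (e p).2, fun p => hC _, fun p => hC' _,
    fun K' hK hK' V hV hne => ?_⟩
  obtain ⟨g, hg⟩ := hne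
  obtain ⟨ζ₀, hζ₀⟩ := (ne_univ_iff_exists_notMem K').1 hK'
  obtain ⟨r, hr, hball⟩ := Metric.isOpen_iff.1 hK.isClosed.isOpen_compl ζ₀ hζ₀
  obtain ⟨l, hl⟩ := exists_nat_one_div_lt (half_pos hr)
  obtain ⟨m, hm⟩ := (TopologicalSpace.denseRange_denseSeq Circle).exists_dist_lt ζ₀ (half_pos hr)
  have hsub : K' ⊆ C (m, l) := by
    intro ζ hζ hζb
    refine hball (?_ : ζ ∈ Metric.ball ζ₀ r) hζ
    have h1 : dist ζ (x m) < 1 / ((l : ℝ) + 1) := hζb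
    have h2 : dist ζ₀ (x m) < r / 2 := hm
    rw [Metric.mem_ball]
    have := dist_triangle_right ζ ζ₀ (x m)
    linarith
  -- Tietze extension of g, so that density of polynomials on the larger set C (m, l) yields one
  -- whose restriction to K' lies in V.
  obtain ⟨G, hG⟩ := ContinuousMap.exists_restrict_eq hK.isClosed g
  let ι : C(K', C (m, l)) := ⟨inclusion hsub, continuous_inclusion hsub⟩
  obtain ⟨n, hn⟩ := (hP (m, l)).exists_mem_open
    (hV.preimage (ContinuousMap.continuous_precomp ι))
    ⟨G.restrict (C (m, l)), by
      change (G.restrict (C (m, l))).comp ι ∈ V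
      rw [show (G.restrict (C (m, l))).comp ι = G.restrict K' from rfl, hG]
      exact hg⟩
  obtain ⟨p, hp⟩ := he ((m, l), n)
  refine ⟨p, ?_, ?_⟩
  · simp only [hp]; exact hsub
  · simp only [hp]; exact hn

theorem mem_classOf_iff {𝒱 : (K : Set Circle) → Set (Set C(K, ℂ))} (h𝒱 : IsBaseChoice 𝒱)
    {Q : Set (Ico (0 : ℝ) 1) → Prop} (hQ : ∀ S T, S ⊆ T → Q S → Q T) {f : HolDisc} :
    f ∈ classOf 𝒱 Q ↔ ∀ K : Set Circle, IsCompact K → K ≠ univ → ∀ V : Set C(K, ℂ),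
      IsOpen V → V.Nonempty → Q (hits f K V) := by
  constructor
  · intro h K hK hK' V hV ⟨g, hg⟩
    obtain ⟨U, hU, -, hUV⟩ := (h𝒱 K hK hK').1.exists_subset_of_mem_open hg hV
    exact hQ _ _ (fun r hr => hUV hr) (h K hK hK' U hU)
  · intro h K hK hK' V hV
    refine h K hK hK' V ((h𝒱 K hK hK').1.isOpen hV) ?_
    rw [nonempty_iff_ne_empty]
    rintro rfl
    exact (h𝒱 K hK hK').2 hV

theorem near_mono {f : HolDisc} {K K' : Set Circle} (hKK : K ⊆ K') {P : Polynomial ℂ} {δ δ' : ℝ}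
    (hδ : δ' ≤ δ) : near f K' P δ' ⊆ near f K P δ :=
  fun _ hr ζ hζ => (hr ζ (hKK hζ)).trans_le hδ

/-- Tubes around the countably many targets are open, and every nonempty open V contains the
restriction to its K' of a sufficiently thin tube. The uncountable quantification over K and V thus
becomes countable, as the Gδ property demands. -/
theorem mem_classOf_iff_near {𝒱 : (K : Set Circle) → Set (Set C(K, ℂ))} (h𝒱 : IsBaseChoice 𝒱)
    {Q : Set (Ico (0 : ℝ) 1) → Prop} (hQ : ∀ S T, S ⊆ T → Q S → Q T) {K : ℕ → Set Circle}
    {P : ℕ → Polynomial ℂ} (hK : ∀ p, IsCompact (K p)) (hK' : ∀ p, K p ≠ univ)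
    (hKP : ∀ K' : Set Circle, IsCompact K' → K' ≠ univ → ∀ V : Set C(K', ℂ), IsOpen V →
      V.Nonempty → ∃ p, K' ⊆ K p ∧ polyTrace (P p) K' ∈ V) {f : HolDisc} :
    f ∈ classOf 𝒱 Q ↔ ∀ p l : ℕ, Q (near f (K p) (P p) (1 / ((l : ℝ) + 1))) := by
  rw [mem_classOf_iff h𝒱 hQ]
  constructor
  · intro h p l
    refine hQ _ _ (fun r hr => ?_) (h (K p) (hK p) (hK' p) _
      (polyTrace_tube (hK p) (P p) (δ := 1 / ((l : ℝ) + 1)) (by positivity))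
      ⟨polyTrace (P p) (K p), fun ζ => ?_⟩)
    · exact fun ζ hζ => hr ⟨ζ, hζ⟩
    · change ‖(P p).eval ((ζ : Circle) : ℂ) - (P p).eval ((ζ : Circle) : ℂ)‖ < _
      rw [sub_self, norm_zero]; positivity
  · intro h K₁ hK₁ hK₁' V hV hne
    obtain ⟨p, hp, hpV⟩ := hKP K₁ hK₁ hK₁' V hV hne
    obtain ⟨δ, hδ, hsub⟩ := exists_tube_subset hK₁ hV hpV
    obtain ⟨l, hl⟩ := exists_nat_one_div_lt hδ
    exact hQ _ _ ((near_mono hp hl.le).trans (hsub f)) (h p l)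

/-! ### The topology of the holomorphic functions and the density criterion -/

theorem exists_radius_polynomial_near (P : Polynomial ℂ) {δ : ℝ} (hδ : 0 < δ) :
    ∃ s₀ < 1, ∀ s : ℝ, s₀ ≤ s → s < 1 → ∀ ζ : Circle,
      ‖P.eval ((s : ℂ) * (ζ : ℂ)) - P.eval (ζ : ℂ)‖ < δ := by
  have huc := (isCompact_closedBall (0 : ℂ) 1).uniformContinuousOn_of_continuous
    (f := fun z => P.eval z) P.continuous.continuousOn
  obtain ⟨η, hη, h⟩ := Metric.uniformContinuousOn_iff.1 huc δ hδ
  refine ⟨max 0 (1 - η / 2), max_lt one_pos (by linarith), fun s hs hs1 ζ => ?_⟩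
  have h0 : 0 ≤ s := (le_max_left _ _).trans hs
  have h1 : 1 - η / 2 ≤ s := (le_max_right _ _).trans hs
  rw [← dist_eq_norm]
  refine h _ ?_ _ ?_ ?_
  · simp [Circle.norm_coe, abs_of_nonneg h0, hs1.le]
  · simp [Circle.norm_coe]
  · rw [dist_eq_norm, show (s : ℂ) * ζ - ζ = ((s - 1 : ℝ) : ℂ) * ζ by push_cast; ring, norm_mul,
      Circle.norm_coe, mul_one, Complex.norm_real, Real.norm_eq_abs, abs_of_neg (by linarith)]
    linarith

/-- The element of `H(𝔻)` given by a function that is holomorphic on the disc. -/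
def holMk (F : ℂ → ℂ) (hF : DifferentiableOn ℂ F (Metric.ball 0 1)) : HolDisc :=
  ⟨⟨fun z => F z, continuousOn_iff_continuous_domRestrict.1 hF.continuousOn⟩, F, hF, fun _ => rfl⟩

theorem holDisc_nhds (f : HolDisc) {R : ℝ} (hR : R < 1) {ε : ℝ} (hε : 0 < ε) :
    ∀ᶠ g in 𝓝 f, ∀ z : Metric.ball (0 : ℂ) 1, ‖(z : ℂ)‖ ≤ R → ‖g.1 z - f.1 z‖ < ε := by
  have h1 : Tendsto (fun g : HolDisc => g.1) (𝓝 f) (𝓝 f.1) := continuous_subtype_val.tendsto f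
  have hC : IsCompact ((↑) ⁻¹' Metric.closedBall (0 : ℂ) R : Set (Metric.ball (0 : ℂ) 1)) := by
    rw [IsEmbedding.subtypeVal.isCompact_iff, Subtype.image_preimage_coe,
      inter_eq_right.2 (Metric.closedBall_subset_ball hR)]
    exact isCompact_closedBall _ _
  have h2 := Metric.tendstoUniformlyOn_iff.1
    (ContinuousMap.tendsto_iff_forall_isCompact_tendstoUniformlyOn.1 h1 _ hC) ε hε
  filter_upwards [h2] with g hg z hz
  rw [← dist_eq_norm, dist_comm]
  exact hg z (by simpa using hz)

theorem dense_of_approx {S : Set HolDisc}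
    (h : ∀ f₀ : HolDisc, ∀ R : ℝ, 0 ≤ R → R < 1 → ∀ ε : ℝ, 0 < ε → ε ≤ 1 → ∃ f ∈ S,
      ∀ z : Metric.ball (0 : ℂ) 1, ‖(z : ℂ)‖ ≤ R → ‖f.1 z - f₀.1 z‖ ≤ ε) : Dense S := by
  intro f₀
  have h0 : ∀ j : ℕ, (0 : ℝ) < 1 / ((j : ℝ) + 1) := fun j => by positivity
  have h1 : ∀ j : ℕ, 1 / ((j : ℝ) + 1) ≤ 1 := fun j => by
    rw [div_le_one (by positivity)]; linarith [(Nat.cast_nonneg j : (0 : ℝ) ≤ j)]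
  choose f hfS hf using fun j : ℕ => h f₀ (1 - 1 / ((j : ℝ) + 1)) (by linarith [h1 j])
    (by linarith [h0 j]) _ (h0 j) (h1 j)
  refine mem_closure_of_tendsto (f := f) (b := atTop) ?_ (Eventually.of_forall hfS)
  rw [tendsto_subtype_rng, ContinuousMap.tendsto_iff_forall_isCompact_tendstoUniformlyOn]
  intro C hC
  obtain ⟨R, hR, hCR⟩ : ∃ R < 1, ∀ z ∈ C, ‖(z : ℂ)‖ ≤ R := by
    rcases C.eq_empty_or_nonempty with rfl | hne
    · exact ⟨0, one_pos, by simp⟩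
    · obtain ⟨z₀, hz₀, hmax⟩ := hC.exists_isMaxOn hne
        (f := fun z : Metric.ball (0 : ℂ) 1 => ‖(z : ℂ)‖) (by fun_prop)
      exact ⟨‖(z₀ : ℂ)‖, mem_ball_zero_iff.1 z₀.2, fun z hz => hmax hz⟩
  rw [Metric.tendstoUniformlyOn_iff]
  intro ε hε
  have ht : Tendsto (fun j : ℕ => 1 / ((j : ℝ) + 1)) atTop (𝓝 0) :=
    tendsto_one_div_add_atTop_nhds_zero_nat
  filter_upwards [ht.eventually (gt_mem_nhds hε), ht.eventually (gt_mem_nhds (sub_pos.2 hR))]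
    with j hj hj' z hz
  rw [dist_comm, dist_eq_norm]
  exact (hf j z ((hCR z hz).trans (by linarith))).trans_lt hj

/-- Layer [a k, b k] is devoted to target q k. At radius s the error is at most 1 - s plus the
variation of P between radii s and 1, so it is below δ once s is near 1; this is why only radii
beyond an arbitrary s₀ < 1 need count. -/
theorem dense_classOf {𝒱 : (K : Set Circle) → Set (Set C(K, ℂ))} (h𝒱 : IsBaseChoice 𝒱)
    {Q : Set (Ico (0 : ℝ) 1) → Prop} (hQ : ∀ S T, S ⊆ T → Q S → Q T)
    (H : ∀ R : ℝ, 0 ≤ R → R < 1 → ∃ (a b : ℕ → ℝ) (q : ℕ → ℕ), R < a 0 ∧ (∀ k, a k ≤ b k) ∧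
      (∀ k, b k < a (k + 1)) ∧ (∀ k, b k < 1) ∧ Tendsto b atTop (𝓝 1) ∧
      ∀ p : ℕ, ∀ s₀ : ℝ, s₀ < 1 →
        Q {r | s₀ ≤ (r : ℝ) ∧ ∃ k, q k = p ∧ (r : ℝ) ∈ Icc (a k) (b k)}) :
    Dense (classOf 𝒱 Q) := by
  obtain ⟨K, P, hK, hK', hKP⟩ := exists_targets
  refine dense_of_approx fun f₀ R hR hR1 ε hε hε1 => ?_
  obtain ⟨a, b, q, hRa, hab, hba, hb, hb1, hq⟩ := H R hR hR1
  obtain ⟨c, F₀, hF₀, hcF⟩ := f₀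
  obtain ⟨F, hF, hFF₀, hFP⟩ := exists_holomorphic_near_seq (K := fun k => K (q k))
    (fun k => hK _) (fun k => hK' _) (fun k => P (q k)) hR hRa hab hba hb hb1 hε hε1 hF₀
  refine ⟨holMk F hF, ?_, fun z hz => ?_⟩
  · rw [mem_classOf_iff_near h𝒱 hQ hK hK' hKP]
    intro p l
    have hδ : (0 : ℝ) < 1 / ((l : ℝ) + 1) := by positivity
    set δ := 1 / ((l : ℝ) + 1)
    obtain ⟨s₀, hs₀, hPs⟩ := exists_radius_polynomial_near (P p) (half_pos hδ)
    refine hQ _ _ ?_ (hq p (max s₀ (1 - δ / 2)) (max_lt hs₀ (by linarith)))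
    rintro r ⟨hr, k, rfl, hrk⟩ ζ hζ
    have h1 := hFP k r hrk ζ hζ
    have h2 := hPs r ((le_max_left _ _).trans hr) r.2.2 ζ
    have h3 := (le_max_right _ _).trans hr
    have h4 := norm_sub_le_norm_sub_add_norm_sub (F ((r : ℝ) * (ζ : ℂ)))
      ((P (q k)).eval (((r : ℝ) : ℂ) * (ζ : ℂ))) ((P (q k)).eval (ζ : ℂ))
    change ‖F ((r : ℝ) * (ζ : ℂ)) - (P (q k)).eval (ζ : ℂ)‖ < δ
    linarith
  · have := hFF₀ z hz
    rw [hcF] at this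
    exact this

/-! ### Baire category for densities given by measures -/

variable {𝒱 : (K : Set Circle) → Set (Set C(K, ℂ))}

/-- Upper density one with respect to a sequence of measures. -/
def UpperOne (μ : ℕ → Measure (Ico (0 : ℝ) 1)) (S : Set (Ico (0 : ℝ) 1)) : Prop :=
  ∀ k N : ℕ, ∃ n ≥ N, 1 - 1 / ((k : ℝ) + 1) < (μ n).real S

/-- Positive lower density with respect to a sequence of measures. -/
def LowerPos (μ : ℕ → Measure (Ico (0 : ℝ) 1)) (S : Set (Ico (0 : ℝ) 1)) : Prop :=
  ∃ c > 0, ∀ᶠ n in atTop, c ≤ (μ n).real S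

theorem UpperOne.mono {μ : ℕ → Measure (Ico (0 : ℝ) 1)} [∀ n, IsFiniteMeasure (μ n)]
    (S T : Set (Ico (0 : ℝ) 1)) (hST : S ⊆ T)
    (hS : UpperOne μ S) : UpperOne μ T := fun k N => by
  obtain ⟨n, hn, h⟩ := hS k N
  exact ⟨n, hn, h.trans_le (measureReal_mono hST)⟩

theorem LowerPos.mono {μ : ℕ → Measure (Ico (0 : ℝ) 1)} [∀ n, IsFiniteMeasure (μ n)]
    (S T : Set (Ico (0 : ℝ) 1)) (hST : S ⊆ T)
    (hS : LowerPos μ S) : LowerPos μ T := by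
  obtain ⟨c, hc, h⟩ := hS
  exact ⟨c, hc, h.mono fun n hn => hn.trans (measureReal_mono hST)⟩

/-- At arbitrarily late n the set T takes all but less than c of the mass, leaving too little for
the disjoint set S. -/
theorem not_lowerPos_of_upperOne {μ : ℕ → Measure (Ico (0 : ℝ) 1)} [∀ n, IsFiniteMeasure (μ n)]
    (hμ1 : ∀ n, (μ n).real univ ≤ 1) {S T : Set (Ico (0 : ℝ) 1)} (hT : MeasurableSet T)
    (hST : Disjoint S T) (h : UpperOne μ T) : ¬ LowerPos μ S := by
  rintro ⟨c, hc, hS⟩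
  obtain ⟨N, hN⟩ := eventually_atTop.1 hS
  obtain ⟨k, hk⟩ := exists_nat_one_div_lt hc
  obtain ⟨n, hn, h⟩ := h k N
  have h1 := hN n hn
  have h2 : (μ n).real S + (μ n).real T ≤ 1 := by
    rw [← measureReal_union hST hT]
    exact (measureReal_mono (subset_univ _)).trans (hμ1 n)
  linarith

theorem exists_lt_of_tendsto {g : ℕ → ℝ} {c : ℝ} {ε : ℝ} (hg : Tendsto g atTop (𝓝 c))
    (hε : 0 < ε) (N : ℕ) : ∃ n, c - ε < g n ∧ N ≤ n :=
  ((hg.eventually (lt_mem_nhds (sub_lt_self c hε))).and (eventually_ge_atTop N)).exists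

/-- By continuity from below, mass above c is already carried by radii ≤ 1 - 1/(j+1) at which the
inequality holds with margin 1/(j+1). Any g uniformly within this margin of f on that closed disc
keeps those radii. -/
theorem isOpen_lt_measure_near {μ : Measure (Ico (0 : ℝ) 1)} [IsFiniteMeasure μ] {K : Set Circle}
    (hK : IsCompact K) (P : Polynomial ℂ) {δ : ℝ} (hδ : 0 < δ) {c : ℝ} (hc : 0 ≤ c) :
    IsOpen {f : HolDisc | c < μ.real (near f K P δ)} := by
  rw [isOpen_iff_mem_nhds]
  intro f hf
  set A : ℕ → Set (Ico (0 : ℝ) 1) := fun j =>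
    {r | (r : ℝ) ≤ 1 - 1 / ((j : ℝ) + 1)} ∩ near f K P (δ - 1 / ((j : ℝ) + 1)) with hA
  have hAmono : Monotone A := by
    intro i j hij r hr
    have h1 : 1 / ((j : ℝ) + 1) ≤ 1 / ((i : ℝ) + 1) := Nat.one_div_le_one_div hij
    refine ⟨?_, near_mono subset_rfl (by linarith) hr.2⟩
    have := hr.1
    simp only [mem_ofPred_eq] at this ⊢
    linarith
  have hAU : near f K P δ ⊆ ⋃ j, A j := by
    intro r hr
    obtain ⟨δ', hδ', hr'⟩ : ∃ δ' < δ, ∀ ζ ∈ K, ‖f.1 (dilation r ζ) - P.eval (ζ : ℂ)‖ ≤ δ' := by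
      rcases K.eq_empty_or_nonempty with rfl | hne
      · exact ⟨0, hδ, by simp⟩
      · have hcont : Continuous fun ζ : Circle => ‖f.1 (dilation r ζ) - P.eval (ζ : ℂ)‖ := by
          have h1 : Continuous fun ζ : Circle => f.1 (dilation r ζ) :=
            f.1.continuous.comp (continuous_dilation r)
          fun_prop
        obtain ⟨ζ₀, hζ₀, hmax⟩ := hK.exists_isMaxOn hne hcont.continuousOn
        exact ⟨_, hr ζ₀ hζ₀, fun ζ hζ => hmax hζ⟩
    obtain ⟨j, hj⟩ := exists_nat_one_div_lt
      (lt_min (sub_pos.2 hδ') (sub_pos.2 r.2.2) : 0 < min (δ - δ') (1 - (r : ℝ)))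
    have h1 := hj.trans_le (min_le_left _ _)
    have h2 := hj.trans_le (min_le_right _ _)
    refine mem_iUnion.2 ⟨j, ?_, fun ζ hζ => (hr' ζ hζ).trans_lt (by linarith)⟩
    simp only [mem_ofPred_eq]
    linarith
  have h1 : ENNReal.ofReal c < ⨆ j, μ (A j) := by
    rw [← hAmono.measure_iUnion]
    have h2 : ENNReal.ofReal c < μ (near f K P δ) :=
      (ENNReal.ofReal_lt_iff_lt_toReal hc (measure_ne_top _ _)).2 hf
    exact h2.trans_le (measure_mono hAU)
  obtain ⟨j, hj⟩ := lt_iSup_iff.1 h1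
  rw [ENNReal.ofReal_lt_iff_lt_toReal hc (measure_ne_top _ _)] at hj
  have hj0 : (0 : ℝ) < 1 / ((j : ℝ) + 1) := by positivity
  filter_upwards [holDisc_nhds f (sub_lt_self 1 hj0) hj0] with g hg
  refine hj.trans_le (measureReal_mono ?_)
  rintro r ⟨hr1, hr2⟩ ζ hζ
  have h3 := hg (dilation r ζ) (by
    simpa [dilation, Circle.norm_coe, abs_of_nonneg r.2.1] using hr1)
  have h4 := hr2 ζ hζ
  have h5 := norm_sub_le_norm_sub_add_norm_sub (g.1 (dilation r ζ)) (f.1 (dilation r ζ))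
    (P.eval (ζ : ℂ))
  linarith

theorem isGδ_classOf_upperOne (h𝒱 : IsBaseChoice 𝒱) {μ : ℕ → Measure (Ico (0 : ℝ) 1)}
    [∀ n, IsFiniteMeasure (μ n)] : IsGδ (classOf 𝒱 (UpperOne μ)) := by
  obtain ⟨K, P, hK, hK', hKP⟩ := exists_targets
  have h1 : classOf 𝒱 (UpperOne μ) = ⋂ (p : ℕ) (l : ℕ) (k : ℕ) (N : ℕ), ⋃ n ≥ N,
      {f | 1 - 1 / ((k : ℝ) + 1) < (μ n).real (near f (K p) (P p) (1 / ((l : ℝ) + 1)))} := by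
    ext f
    rw [mem_classOf_iff_near h𝒱 UpperOne.mono hK hK' hKP]
    simp only [UpperOne, mem_iInter, mem_iUnion, mem_ofPred_eq, exists_prop]
  rw [h1]
  refine .iInter fun p => .iInter fun l => .iInter fun k => .iInter fun N => IsOpen.isGδ ?_
  refine isOpen_biUnion fun n _ => isOpen_lt_measure_near (hK p) _ (by positivity) ?_
  rw [sub_nonneg, div_le_one (by positivity)]
  linarith [(Nat.cast_nonneg k : (0 : ℝ) ≤ k)]

theorem dense_classOf_upperOne (h𝒱 : IsBaseChoice 𝒱) {μ : ℕ → Measure (Ico (0 : ℝ) 1)}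
    [∀ n, IsFiniteMeasure (μ n)] (hμ1 : Tendsto (fun n => (μ n).real univ) atTop (𝓝 1))
    (hμ : ∀ t < 1, Tendsto (fun n => (μ n).real {r | (r : ℝ) ≤ t}) atTop (𝓝 0)) :
    Dense (classOf 𝒱 (UpperOne μ)) := by
  -- Choose a beyond t first: the mass above a tends to 1, which yields n; continuity from below
  -- then allows truncation at some b < 1.
  have step : ∀ (k : ℕ) (t : {t : ℝ // t < 1}), ∃ (a : ℝ) (b : {t : ℝ // t < 1}), t < a ∧
      1 - 1 / ((k : ℝ) + 1) ≤ a ∧ a ≤ b ∧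
      ∃ n ≥ k, 1 - 1 / ((k : ℝ) + 1) < (μ n).real {r | (r : ℝ) ∈ Icc a b} := by
    rintro k ⟨t, ht⟩
    have hk0 : (0 : ℝ) < 1 / ((k : ℝ) + 1) := by positivity
    obtain ⟨a, hta, ha⟩ := exists_between (max_lt ht (sub_lt_self 1 hk0))
    have h1 : Tendsto (fun n => (μ n).real {r | a < (r : ℝ)}) atTop (𝓝 1) := by
      have h2 := hμ1.sub (hμ a ha)
      rw [sub_zero] at h2
      refine h2.congr fun n => ?_
      have hm : MeasurableSet {r : Ico (0 : ℝ) 1 | (r : ℝ) ≤ a} :=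
        measurableSet_le measurable_subtype_coe measurable_const
      rw [← measureReal_compl hm]
      congr 1
      ext r
      simp
    obtain ⟨n, hn, hkn⟩ := exists_lt_of_tendsto h1 hk0 k
    have hmono : Monotone fun j : ℕ =>
        {r : Ico (0 : ℝ) 1 | a < (r : ℝ) ∧ (r : ℝ) ≤ 1 - 1 / ((j : ℝ) + 1)} := by
      intro i j hij r hr
      have h1 : 1 / ((j : ℝ) + 1) ≤ 1 / ((i : ℝ) + 1) := Nat.one_div_le_one_div hij
      exact ⟨hr.1, hr.2.trans (by linarith)⟩
    have hU : {r : Ico (0 : ℝ) 1 | a < (r : ℝ)} ⊆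
        ⋃ j : ℕ, {r | a < (r : ℝ) ∧ (r : ℝ) ≤ 1 - 1 / ((j : ℝ) + 1)} := by
      intro r hr
      obtain ⟨j, hj⟩ := exists_nat_one_div_lt (sub_pos.2 r.2.2)
      exact mem_iUnion.2 ⟨j, hr, by linarith⟩
    have hk1 : 0 ≤ 1 - 1 / ((k : ℝ) + 1) := by
      rw [sub_nonneg, div_le_one (by positivity)]
      linarith [(Nat.cast_nonneg k : (0 : ℝ) ≤ k)]
    have h2 : ENNReal.ofReal (1 - 1 / ((k : ℝ) + 1)) <
        ⨆ j : ℕ, μ n {r | a < (r : ℝ) ∧ (r : ℝ) ≤ 1 - 1 / ((j : ℝ) + 1)} := by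
      rw [← hmono.measure_iUnion]
      exact ((ENNReal.ofReal_lt_iff_lt_toReal hk1 (measure_ne_top _ _)).2 hn).trans_le
        (measure_mono hU)
    obtain ⟨j, hj⟩ := lt_iSup_iff.1 h2
    rw [ENNReal.ofReal_lt_iff_lt_toReal hk1 (measure_ne_top _ _)] at hj
    have hj0 : (0 : ℝ) < 1 / ((j : ℝ) + 1) := by positivity
    refine ⟨a, ⟨max a (1 - 1 / ((j : ℝ) + 1)), max_lt ha (by linarith)⟩,
      (le_max_left _ _).trans_lt hta, ((le_max_right _ _).trans_lt hta).le, le_max_left _ _,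
      n, hkn, hj.trans_le (measureReal_mono fun r hr => ?_)⟩
    exact ⟨hr.1.le, hr.2.trans (le_max_right _ _)⟩
  choose A B hA hA' hAB hn using step
  refine dense_classOf h𝒱 UpperOne.mono fun R hR hR1 => ?_
  let t : ℕ → {t : ℝ // t < 1} := fun k => Nat.rec ⟨R, hR1⟩ (fun k s => B k s) k
  have htend : Tendsto (fun k : ℕ => 1 - 1 / ((k : ℝ) + 1)) atTop (𝓝 1) := by
    simpa using (tendsto_one_div_add_atTop_nhds_zero_nat (𝕜 := ℝ)).const_sub 1
  -- The first coordinate of unpairing takes each value p infinitely often.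
  refine ⟨fun k => A k (t k), fun k => t (k + 1), fun k => k.unpair.1, hA 0 (t 0),
    fun k => hAB k _, fun k => hA (k + 1) _, fun k => (t (k + 1)).2, ?_, ?_⟩
  · exact tendsto_of_tendsto_of_tendsto_of_le_of_le htend tendsto_const_nhds
      (fun k => (hA' k _).trans (hAB k _)) (fun k => (t (k + 1)).2.le)
  · intro p s₀ hs₀ k N
    obtain ⟨m, hm⟩ := (htend.eventually (lt_mem_nhds hs₀)).exists_forall_of_atTop
    set i := Nat.pair p (m + k + N)
    have hi : m + k + N ≤ i := Nat.right_le_pair _ _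
    obtain ⟨n, hni, h⟩ := hn i (t i)
    have h1 : 1 / ((i : ℝ) + 1) ≤ 1 / ((k : ℝ) + 1) := Nat.one_div_le_one_div (by omega)
    refine ⟨n, by omega, (by linarith : _ ≤ 1 - 1 / ((i : ℝ) + 1)).trans_lt
      (h.trans_le (measureReal_mono fun r hr => ⟨?_, i, by simp [i], hr⟩))⟩
    exact (hm i (by omega)).le.trans ((hA' i _).trans hr.1)

theorem isMeagre_classOf_lowerPos (h𝒱 : IsBaseChoice 𝒱) {μ : ℕ → Measure (Ico (0 : ℝ) 1)}
    [∀ n, IsFiniteMeasure (μ n)] (hμ1 : Tendsto (fun n => (μ n).real univ) atTop (𝓝 1))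
    (hμ1' : ∀ n, (μ n).real univ ≤ 1)
    (hμ : ∀ t < 1, Tendsto (fun n => (μ n).real {r | (r : ℝ) ≤ t}) atTop (𝓝 0)) :
    IsMeagre (classOf 𝒱 (LowerPos μ)) := by
  rw [IsMeagre]
  refine mem_of_superset (residual_of_dense_Gδ (isGδ_classOf_upperOne h𝒱 (μ := μ))
    (dense_classOf_upperOne h𝒱 hμ1 hμ)) fun f hf hf' => ?_
  rw [mem_classOf_iff h𝒱 UpperOne.mono] at hf
  rw [mem_classOf_iff h𝒱 LowerPos.mono] at hf'
  have hK : IsCompact ({1} : Set Circle) := isCompact_singleton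
  have hK' : ({1} : Set Circle) ≠ univ := by
    refine (ne_univ_iff_exists_notMem _).2 ⟨-1, fun h => ?_⟩
    have h1 : (-1 : Circle) = 1 := h
    have h2 := congrArg (fun z : Circle => (z : ℂ)) h1
    norm_num at h2
  let e : C(({1} : Set Circle), ℂ) → ℂ := fun g => g ⟨1, rfl⟩
  have he : Continuous e := continuous_eval_const _
  have hopen : ∀ w : ℂ, IsOpen (e ⁻¹' Metric.ball w 1) := fun w =>
    Metric.isOpen_ball.preimage he
  have hne : ∀ w : ℂ, (e ⁻¹' Metric.ball w 1).Nonempty := fun w =>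
    ⟨ContinuousMap.const _ w, Metric.mem_ball_self one_pos⟩
  have hdil : Continuous fun r : Ico (0 : ℝ) 1 => dilation r 1 := by
    unfold dilation
    fun_prop
  -- The unit balls around 0 and 3 are disjoint, so f cannot be in either of them at the same
  -- radius.
  refine not_lowerPos_of_upperOne hμ1' ?_ ?_ (hf _ hK hK' _ (hopen 3) (hne 3))
    (hf' _ hK hK' _ (hopen 0) (hne 0))
  · exact (Metric.isOpen_ball.preimage (f.1.continuous.comp hdil)).measurableSet
  · rw [Set.disjoint_left]
    intro r hr hr'
    have h1 : dist (f.1 (dilation r 1)) 0 < 1 := hr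
    have h2 : dist (f.1 (dilation r 1)) 3 < 1 := hr'
    have h3 := dist_triangle_left (0 : ℂ) 3 (f.1 (dilation r 1))
    have h4 : dist (0 : ℂ) 3 = 3 := by simp
    linarith

/-! ### The densities of the statement as masses of measures -/

theorem liminf_pos_iff {u : ℕ → ℝ} (h0 : ∀ n, 0 ≤ u n) (h1 : ∀ n, u n ≤ 1) :
    0 < liminf u atTop ↔ ∃ c > 0, ∀ᶠ n in atTop, c ≤ u n := by
  have hb : IsBoundedUnder (· ≥ ·) atTop u := isBoundedUnder_of ⟨0, h0⟩
  have hB : IsBoundedUnder (· ≤ ·) atTop u := isBoundedUnder_of ⟨1, h1⟩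
  constructor
  · intro h
    obtain ⟨c, hc0, hc⟩ := exists_between h
    exact ⟨c, hc0, (eventually_lt_of_lt_liminf hc hb).mono fun n hn => hn.le⟩
  · rintro ⟨c, hc, h⟩
    exact hc.trans_le (le_liminf_of_le hB.isCoboundedUnder_ge h)

theorem liminf_eq_zero_iff {u : ℕ → ℝ} (h0 : ∀ n, 0 ≤ u n) (h1 : ∀ n, u n ≤ 1) :
    liminf u atTop = 0 ↔ ∀ k N : ℕ, ∃ n ≥ N, u n < 1 / ((k : ℝ) + 1) := by
  have hB : IsBoundedUnder (· ≤ ·) atTop u := isBoundedUnder_of ⟨1, h1⟩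
  have hnn : 0 ≤ liminf u atTop :=
    le_liminf_of_le hB.isCoboundedUnder_ge (Eventually.of_forall h0)
  rw [← not_iff_not, ← ne_eq, ← hnn.lt_iff_ne', liminf_pos_iff h0 h1]
  push Not
  constructor
  · rintro ⟨c, hc, h⟩
    obtain ⟨N, hN⟩ := eventually_atTop.1 h
    obtain ⟨k, hk⟩ := exists_nat_one_div_lt hc
    exact ⟨k, N, fun n hn => hk.le.trans (hN n hn)⟩
  · rintro ⟨k, N, h⟩
    exact ⟨_, by positivity, eventually_atTop.2 ⟨N, h⟩⟩

theorem limsup_eq_one_iff {u : ℕ → ℝ} (h0 : ∀ n, 0 ≤ u n) (h1 : ∀ n, u n ≤ 1) :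
    limsup u atTop = 1 ↔ ∀ k N : ℕ, ∃ n ≥ N, 1 - 1 / ((k : ℝ) + 1) < u n := by
  have hb : IsBoundedUnder (· ≥ ·) atTop u := isBoundedUnder_of ⟨0, h0⟩
  have hB : IsBoundedUnder (· ≤ ·) atTop u := isBoundedUnder_of ⟨1, h1⟩
  constructor
  · intro h k N
    have hk0 : (0 : ℝ) < 1 / ((k : ℝ) + 1) := by positivity
    have hf : ∃ᶠ n in atTop, 1 - 1 / ((k : ℝ) + 1) < u n :=
      frequently_lt_of_lt_limsup hb.isCoboundedUnder_le (by rw [h]; linarith)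
    exact frequently_atTop.1 hf N
  · intro h
    refine le_antisymm (limsup_le_of_le hb.isCoboundedUnder_le (Eventually.of_forall h1)) ?_
    refine le_of_forall_pos_lt_add fun ε hε => ?_
    obtain ⟨k, hk⟩ := exists_nat_one_div_lt hε
    have := le_limsup_of_frequently_le (f := atTop)
      ((frequently_atTop.2 (h k)).mono fun n hn => hn.le) hB
    linarith

/-- The uniform measures on the first `n` terms of a sequence. -/
noncomputable def seqMeasure (ϱ : ℕ → Ico (0 : ℝ) 1) (n : ℕ) : Measure (Ico (0 : ℝ) 1) :=
  (n : NNReal)⁻¹ • ∑ i ∈ Finset.Icc 1 n, Measure.dirac (ϱ i)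

instance (ϱ : ℕ → Ico (0 : ℝ) 1) (n : ℕ) : IsFiniteMeasure (seqMeasure ϱ n) := by
  unfold seqMeasure
  infer_instance

theorem seqMeasure_real (ϱ : ℕ → Ico (0 : ℝ) 1) (n : ℕ) (S : Set (Ico (0 : ℝ) 1)) :
    (seqMeasure ϱ n).real S = ((ϱ ⁻¹' S ∩ Icc 1 n).ncard : ℝ) / n := by
  classical
  have h1 : ϱ ⁻¹' S ∩ Icc 1 n = ↑((Finset.Icc 1 n).filter fun i => ϱ i ∈ S) := by
    ext i
    simp [and_comm]
  rw [h1, ncard_coe_finset, Finset.card_filter, seqMeasure, measureReal_nnreal_smul_apply,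
    Measure.real, Measure.finsetSum_apply, ENNReal.toReal_sum (fun i _ => measure_ne_top _ _),
    div_eq_inv_mul]
  simp only [Measure.dirac_apply]
  push_cast
  congr 1
  refine Finset.sum_congr rfl fun i _ => ?_
  by_cases h : ϱ i ∈ S <;> simp [h]

/-- The uniform measures on the intervals `[1 - 1/n, 1)`. -/
noncomputable def radMeasure (n : ℕ) : Measure (Ico (0 : ℝ) 1) :=
  (n : NNReal) • (volume.restrict (Ico (1 - 1 / (n : ℝ)) 1)).comap Subtype.val

instance (n : ℕ) : IsFiniteMeasure (radMeasure n) := by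
  have : IsFiniteMeasure ((volume.restrict (Ico (1 - 1 / (n : ℝ)) 1)).comap
      (Subtype.val : Ico (0 : ℝ) 1 → ℝ)) := ⟨by
    rw [(MeasurableEmbedding.subtype_coe measurableSet_Ico).comap_apply]
    exact measure_lt_top _ _⟩
  unfold radMeasure
  infer_instance

theorem radMeasure_real (n : ℕ) (S : Set (Ico (0 : ℝ) 1)) :
    (radMeasure n).real S =
      (n : ℝ) * volume.real (Subtype.val '' S ∩ Ico (1 - 1 / (n : ℝ)) 1) := by
  rw [radMeasure, measureReal_nnreal_smul_apply, Measure.real,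
    (MeasurableEmbedding.subtype_coe measurableSet_Ico).comap_apply,
    Measure.restrict_apply' measurableSet_Ico]
  rfl

theorem seqMeasure_univ (ϱ : ℕ → Ico (0 : ℝ) 1) {n : ℕ} (hn : 1 ≤ n) :
    (seqMeasure ϱ n).real univ = 1 := by
  rw [seqMeasure_real, preimage_univ, univ_inter, ← Finset.coe_Icc, ncard_coe_finset,
    Nat.card_Icc, Nat.add_sub_cancel, div_self]
  exact_mod_cast (by omega : n ≠ 0)

theorem radMeasure_univ {n : ℕ} (hn : 1 ≤ n) : (radMeasure n).real univ = 1 := by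
  have hn' : (1 : ℝ) ≤ n := by exact_mod_cast hn
  have h1 : 1 / (n : ℝ) ≤ 1 := by rw [div_le_one (by linarith)]; exact hn'
  have h2 : 0 < 1 / (n : ℝ) := by positivity
  rw [radMeasure_real, image_univ, Subtype.range_val,
    inter_eq_right.2 (Ico_subset_Ico_left (by linarith)), Real.volume_real_Ico_of_le (by linarith)]
  field_simp
  ring

theorem real_le_one_of_univ {μ : ℕ → Measure (Ico (0 : ℝ) 1)} [∀ n, IsFiniteMeasure (μ n)]
    (h0 : (μ 0).real univ = 0) (h : ∀ n, 1 ≤ n → (μ n).real univ = 1) (n : ℕ)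
    (S : Set (Ico (0 : ℝ) 1)) : (μ n).real S ≤ 1 := by
  refine (measureReal_mono (subset_univ S)).trans ?_
  rcases Nat.eq_zero_or_pos n with rfl | hn
  · rw [h0]; exact zero_le_one
  · exact (h n hn).le

theorem seqMeasure_le_one (ϱ : ℕ → Ico (0 : ℝ) 1) (n : ℕ) (S : Set (Ico (0 : ℝ) 1)) :
    (seqMeasure ϱ n).real S ≤ 1 :=
  real_le_one_of_univ (by simp [seqMeasure_real]) (fun _ => seqMeasure_univ ϱ) n S

theorem radMeasure_le_one (n : ℕ) (S : Set (Ico (0 : ℝ) 1)) : (radMeasure n).real S ≤ 1 :=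
  real_le_one_of_univ (by simp [radMeasure_real]) (fun _ => radMeasure_univ) n S

theorem seqMeasure_tendsto {ϱ : ℕ → Ico (0 : ℝ) 1}
    (hϱ : Tendsto (fun n => (ϱ n : ℝ)) atTop (𝓝 1)) {t : ℝ} (ht : t < 1) :
    Tendsto (fun n => (seqMeasure ϱ n).real {r | (r : ℝ) ≤ t}) atTop (𝓝 0) := by
  obtain ⟨N, hN⟩ := (hϱ.eventually (lt_mem_nhds ht)).exists_forall_of_atTop
  refine squeeze_zero (fun n => measureReal_nonneg) (fun n => ?_)
    (tendsto_const_div_atTop_nhds_zero_nat (N : ℝ))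
  rw [seqMeasure_real]
  gcongr
  have h1 : ϱ ⁻¹' {r | (r : ℝ) ≤ t} ∩ Icc 1 n ⊆ ↑(Finset.range N) := by
    rintro i ⟨hi, -⟩
    by_contra hiN
    have h2 := hN i (by simpa using hiN)
    exact absurd hi (not_le.2 h2)
  simpa using ncard_le_ncard h1 (Finset.finite_toSet _)

theorem radMeasure_tendsto {t : ℝ} (ht : t < 1) :
    Tendsto (fun n => (radMeasure n).real {r | (r : ℝ) ≤ t}) atTop (𝓝 0) := by
  have h1 : Tendsto (fun n : ℕ => 1 - 1 / (n : ℝ)) atTop (𝓝 1) := by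
    simpa using (tendsto_const_div_atTop_nhds_zero_nat (1 : ℝ)).const_sub 1
  refine tendsto_const_nhds.congr' ?_
  filter_upwards [h1.eventually (lt_mem_nhds ht)] with n hn
  rw [radMeasure_real]
  have h2 : Subtype.val '' {r : Ico (0 : ℝ) 1 | (r : ℝ) ≤ t} ∩ Ico (1 - 1 / (n : ℝ)) 1 = ∅ := by
    rw [eq_empty_iff_forall_notMem]
    rintro _ ⟨⟨r, hr, rfl⟩, hr'⟩
    have h3 : (r : ℝ) ≤ t := hr
    have h4 := hr'.1
    linarith
  rw [h2]
  simp

theorem tendsto_real_univ {μ : ℕ → Measure (Ico (0 : ℝ) 1)}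
    (h : ∀ n, 1 ≤ n → (μ n).real univ = 1) : Tendsto (fun n => (μ n).real univ) atTop (𝓝 1) :=
  tendsto_const_nhds.congr' ((eventually_ge_atTop 1).mono fun n hn => (h n hn).symm)

theorem hitRadii_eq (f : HolDisc) (K : Set Circle) (V : Set C(K, ℂ)) :
    hitRadii f K V = Subtype.val '' hits f K V := by
  ext r
  constructor
  · rintro ⟨hr, h⟩
    exact ⟨⟨r, hr⟩, h, rfl⟩
  · rintro ⟨⟨r, hr⟩, h, rfl⟩
    exact ⟨hr, h⟩

theorem isOpen_hits (f : HolDisc) {K : Set Circle} {V : Set C(K, ℂ)}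
    (hV : IsOpen V) : IsOpen (hits f K V) := by
  refine hV.preimage (f := fun r => radialTrace f r K) ?_
  refine ContinuousMap.continuous_of_continuous_uncurry _ ?_
  refine f.1.continuous.comp ?_
  unfold dilation
  fun_prop

variable {ϱ : ℕ → Ico (0 : ℝ) 1}

theorem fuAlong_eq : FUAlong 𝒱 ϱ = classOf 𝒱 (LowerPos (seqMeasure ϱ)) := by
  ext f
  refine forall₅_congr fun K _ _ V _ => ?_
  refine (liminf_pos_iff (fun n => by positivity) fun n => ?_).trans ?_
  · exact (seqMeasure_real ϱ n (hits f K V)).symm.le.trans (seqMeasure_le_one ϱ n _)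
  · simp only [LowerPos, seqMeasure_real]
    rfl

theorem upperOneFUAlong_eq : UpperOneFUAlong 𝒱 ϱ = classOf 𝒱 (UpperOne (seqMeasure ϱ)) := by
  ext f
  refine forall₅_congr fun K _ _ V _ => ?_
  refine (limsup_eq_one_iff (fun n => by positivity) fun n => ?_).trans ?_
  · exact (seqMeasure_real ϱ n (hits f K V)).symm.le.trans (seqMeasure_le_one ϱ n _)
  · simp only [UpperOne, seqMeasure_real]
    rfl

theorem fu_eq : FU 𝒱 = classOf 𝒱 (LowerPos radMeasure) := by
  ext f
  refine forall₅_congr fun K _ _ V _ => ?_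
  rw [hitRadii_eq]
  refine (liminf_pos_iff (fun n => by positivity) fun n => ?_).trans ?_
  · exact (radMeasure_real n (hits f K V)).symm.le.trans (radMeasure_le_one n _)
  · simp only [LowerPos, radMeasure_real]

/-- The uniform upper density is defined through the complement; passing back to the hit set uses
its measurability, which comes from openness of V. -/
theorem upperOneFU_eq (h𝒱 : IsBaseChoice 𝒱) : UpperOneFU 𝒱 = classOf 𝒱 (UpperOne radMeasure) := by
  ext f
  refine forall₅_congr fun K hK hK' V hV => ?_
  have hm := (isOpen_hits f ((h𝒱 K hK hK').1.isOpen hV)).measurableSet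
  have hc : Ico (0 : ℝ) 1 \ hitRadii f K V = Subtype.val '' (hits f K V)ᶜ := by
    rw [hitRadii_eq, image_compl_eq_range_sdiff_image Subtype.val_injective, Subtype.range_val]
  rw [uniformUpperDensity, hc, sub_eq_self]
  refine (liminf_eq_zero_iff (fun n => by positivity) fun n => ?_).trans ?_
  · exact (radMeasure_real n (hits f K V)ᶜ).symm.le.trans (radMeasure_le_one n _)
  · simp only [← radMeasure_real, UpperOne]
    -- False at n = 0, where `radMeasure` vanishes; hence the shift to N + 1 below.
    have key : ∀ n : ℕ, 1 ≤ n →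
        (radMeasure n).real (hits f K V)ᶜ = 1 - (radMeasure n).real (hits f K V) := fun n hn => by
      rw [measureReal_compl hm, radMeasure_univ hn]
    constructor
    · intro h k N
      obtain ⟨n, hn, h1⟩ := h k (N + 1)
      rw [key n (by omega)] at h1
      exact ⟨n, by omega, by linarith⟩
    · intro h k N
      obtain ⟨n, hn, h1⟩ := h k (N + 1)
      refine ⟨n, by omega, ?_⟩
      rw [key n (by omega)]
      linarith

/-! ### Density of the frequently universal classes via 2-adic valuations -/

theorem padicValNat_two_pow_mul_odd (p i : ℕ) : padicValNat 2 (2 ^ p * (2 * i + 1)) = p := by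
  rw [padicValNat.mul (by positivity) (by omega), padicValNat.prime_pow,
    padicValNat.eq_zero_of_not_dvd (by omega), add_zero]

/-- Layers at distance comparable to 2^(-k) from the circle go to target v₂(k + 1). Indices of one
valuation have bounded gaps, so each interval [1 - 1/n, 1) contains a layer of the target occupying
a fixed fraction of it. -/
theorem dense_fu (h𝒱 : IsBaseChoice 𝒱) : Dense (classOf 𝒱 (LowerPos radMeasure)) := by
  refine dense_classOf h𝒱 LowerPos.mono fun R hR hR1 => ?_
  obtain ⟨k₀, hk₀⟩ := exists_pow_lt_of_lt_one (sub_pos.2 hR1) (one_half_lt_one (α := ℝ))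
  set d : ℕ → ℝ := fun k => (1 / 2) ^ (k + k₀) with hd
  have hd0 : ∀ k, 0 < d k := fun k => by positivity
  have hds : ∀ k, d (k + 1) = d k / 2 := fun k => by
    simp only [hd]
    rw [show k + 1 + k₀ = k + k₀ + 1 by ring, pow_succ]
    ring
  refine ⟨fun k => 1 - d k, fun k => 1 - 3 / 4 * d k, fun k => padicValNat 2 (k + 1), ?_,
    fun k => ?_, fun k => ?_, fun k => ?_, ?_, fun p s₀ hs₀ => ?_⟩
  · simp only [hd, zero_add]
    linarith
  · linarith [hd0 k]
  · simp only [hds]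
    linarith [hd0 k]
  · linarith [hd0 k]
  · have h1 : Tendsto d atTop (𝓝 0) := (tendsto_add_atTop_iff_nat k₀).2
      (tendsto_pow_atTop_nhds_zero_of_lt_one (by norm_num) (by norm_num))
    simpa using (h1.const_mul (3 / 4)).const_sub 1
  -- The chosen layer has length d k / 4 with d k ≥ 2^(-(3·2^p + k₀))/(2n); multiplying by n gives
  -- this constant.
  · refine ⟨1 / 8 * (1 / 2) ^ (3 * 2 ^ p + k₀), by positivity, ?_⟩
    filter_upwards [eventually_ge_atTop 1,
      (tendsto_const_div_atTop_nhds_zero_nat (1 : ℝ)).eventually (gt_mem_nhds (sub_pos.2 hs₀))]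
      with n hn hns
    have hn0 : (0 : ℝ) < n := by exact_mod_cast hn
    set m := Nat.log 2 n + 1 with hm
    have hm1 : n < 2 ^ m := Nat.lt_pow_succ_log_self one_lt_two n
    have hm2 : 2 ^ m ≤ 2 * n := by
      rw [hm, pow_succ, mul_comm]
      exact Nat.mul_le_mul_left 2 (Nat.pow_log_le_self 2 (by omega))
    -- This makes k + 1 of valuation p with m ≤ k ≤ m + 3·2^p: large enough to lie in [1 - 1/n, 1),
    -- yet not much larger.
    set i := m / 2 ^ (p + 1) + 1 with hi
    obtain ⟨k, hk⟩ : ∃ k, k + 1 = 2 ^ p * (2 * i + 1) :=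
      Nat.exists_eq_add_one.2 (by positivity) |>.imp fun k h => h.symm
    have hdm := Nat.div_add_mod m (2 ^ (p + 1))
    have hmod : m % 2 ^ (p + 1) < 2 ^ (p + 1) := Nat.mod_lt _ (by positivity)
    have hk' : k + 1 = 2 ^ (p + 1) * (m / 2 ^ (p + 1)) + 2 ^ (p + 1) + 2 ^ p := by
      rw [hk, hi]; ring
    have h2p : 2 ^ (p + 1) = 2 * 2 ^ p := by ring
    have h1p : 1 ≤ 2 ^ p := Nat.one_le_two_pow
    have hmk : m ≤ k := by omega
    have hkm : k ≤ m + 3 * 2 ^ p := by omega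
    have hdk1 : d k ≤ 1 / n := by
      calc d k ≤ (1 / 2) ^ m := pow_le_pow_of_le_one (by norm_num) (by norm_num) (by omega)
        _ = 1 / 2 ^ m := by rw [one_div_pow]
        _ ≤ 1 / n := one_div_le_one_div_of_le hn0 (by exact_mod_cast hm1.le)
    have hdk2 : 1 / (2 * n) * (1 / 2) ^ (3 * 2 ^ p + k₀) ≤ d k := by
      calc 1 / (2 * (n : ℝ)) * (1 / 2) ^ (3 * 2 ^ p + k₀)
          ≤ (1 / 2 ^ m) * (1 / 2) ^ (3 * 2 ^ p + k₀) := by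
            gcongr
            exact_mod_cast hm2
        _ = (1 / 2) ^ (m + (3 * 2 ^ p + k₀)) := by rw [pow_add _ m, one_div_pow (2 : ℝ) m]
        _ ≤ d k := pow_le_pow_of_le_one (by norm_num) (by norm_num) (by omega)
    have hn1 : 1 / (n : ℝ) ≤ 1 := by
      rw [div_le_one hn0]; exact_mod_cast hn
    rw [radMeasure_real]
    have hsub : Icc (1 - d k) (1 - 3 / 4 * d k) ⊆ Subtype.val '' {r : Ico (0 : ℝ) 1 | s₀ ≤ (r : ℝ) ∧
        ∃ k, padicValNat 2 (k + 1) = p ∧ (r : ℝ) ∈ Icc (1 - d k) (1 - 3 / 4 * d k)} ∩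
        Ico (1 - 1 / (n : ℝ)) 1 := by
      intro r hr
      have hr1 := hr.1
      have hr2 := hr.2
      have := hd0 k
      refine ⟨⟨⟨r, by linarith, by linarith⟩, ⟨?_, k, ?_, hr⟩, rfl⟩, by linarith, by linarith⟩
      · simp only
        linarith
      · rw [hk, padicValNat_two_pow_mul_odd]
    have hvol : d k / 4 ≤ volume.real (Subtype.val '' {r : Ico (0 : ℝ) 1 | s₀ ≤ (r : ℝ) ∧
        ∃ k, padicValNat 2 (k + 1) = p ∧ (r : ℝ) ∈ Icc (1 - d k) (1 - 3 / 4 * d k)} ∩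
        Ico (1 - 1 / (n : ℝ)) 1) := by
      have h3 := measureReal_mono (μ := volume) hsub
        (measure_ne_top_of_subset inter_subset_right
          (by rw [Real.volume_Ico]; exact ENNReal.ofReal_ne_top))
      rw [Real.volume_real_Icc_of_le (by linarith [hd0 k])] at h3
      linarith
    calc 1 / 8 * (1 / 2 : ℝ) ^ (3 * 2 ^ p + k₀)
        = n * ((1 / (2 * n) * (1 / 2) ^ (3 * 2 ^ p + k₀)) / 4) := by field_simp; norm_num
      _ ≤ n * (d k / 4) := by gcongr
      _ ≤ _ := by gcongr

/-- As ϱ tends to 1, only finitely many terms lie below a given term, so a least term beyond t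
exists. -/
theorem exists_next (hϱ : Tendsto (fun n => (ϱ n : ℝ)) atTop (𝓝 1)) {t : ℝ} (ht : t < 1) :
    ∃ n, t < ϱ n ∧ ∀ m, t < ϱ m → ϱ n ≤ ϱ m := by
  obtain ⟨n₁, hn₁⟩ := (hϱ.eventually (lt_mem_nhds ht)).exists
  obtain ⟨N, hN⟩ := (hϱ.eventually (lt_mem_nhds (ϱ n₁).2.2)).exists_forall_of_atTop
  have hfin : {m | t < ϱ m ∧ ϱ m ≤ ϱ n₁}.Finite := by
    refine (finite_lt_nat N).subset fun m hm => ?_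
    by_contra h
    exact absurd (hN m (not_lt.1 h)) (not_lt.2 hm.2)
  obtain ⟨n, hn, hmin⟩ := exists_min_image _ ϱ hfin ⟨n₁, hn₁, le_rfl⟩
  refine ⟨n, hn.1, fun m hm => ?_⟩
  rcases le_total (ϱ m) (ϱ n₁) with h | h
  · exact hmin m ⟨hm, h⟩
  · exact hn.2.trans h

/-- The terms of `ϱ` beyond `R` can be listed in increasing order. -/
theorem exists_increasing_enumeration (hϱ : Tendsto (fun n => (ϱ n : ℝ)) atTop (𝓝 1))
    (hinj : Function.Injective ϱ) {R : ℝ} (hR : R < 1) :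
    ∃ σ : ℕ → ℕ, R < ϱ (σ 0) ∧ StrictMono (fun k => ϱ (σ k)) ∧
      ∀ n, R < ϱ n → ∃ k, σ k = n := by
  choose next hnext hmin using fun t : {t : ℝ // t < 1} => exists_next hϱ t.2
  let σ : ℕ → ℕ := fun k => Nat.rec (next ⟨R, hR⟩) (fun _ m => next ⟨ϱ m, (ϱ m).2.2⟩) k
  have hσs : ∀ k, σ (k + 1) = next ⟨ϱ (σ k), (ϱ (σ k)).2.2⟩ := fun k => rfl
  have hmono : StrictMono (fun k => ϱ (σ k)) := strictMono_nat_of_lt_succ fun k => by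
    have := hnext ⟨ϱ (σ k), (ϱ (σ k)).2.2⟩
    rw [← hσs] at this
    exact this
  refine ⟨σ, hnext ⟨R, hR⟩, hmono, fun n hn => ?_⟩
  have hσinj : Function.Injective σ := fun i j hij => hmono.injective (congrArg ϱ hij)
  have hlim := hϱ.comp hσinj.nat_tendsto_atTop
  have hex : ∃ k, ϱ n ≤ ϱ (σ k) := by
    obtain ⟨k, hk⟩ := (hlim.eventually (lt_mem_nhds (ϱ n).2.2)).exists
    exact ⟨k, le_of_lt hk⟩
  classical
  refine ⟨Nat.find hex, hinj (le_antisymm ?_ (Nat.find_spec hex))⟩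
  rcases h : Nat.find hex with _ | k
  · exact hmin ⟨R, hR⟩ n hn
  · rw [hσs]
    refine hmin _ n ?_
    exact not_le.1 (Nat.find_min hex (m := k) (by omega))

theorem dense_fuAlong (h𝒱 : IsBaseChoice 𝒱) (hϱ : Tendsto (fun n => (ϱ n : ℝ)) atTop (𝓝 1))
    (hinj : Function.Injective ϱ) : Dense (classOf 𝒱 (LowerPos (seqMeasure ϱ))) := by
  refine dense_classOf h𝒱 LowerPos.mono fun R hR hR1 => ?_
  obtain ⟨σ, hσ0, hmono, hσ⟩ := exists_increasing_enumeration hϱ hinj hR1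
  have hσinj : Function.Injective σ := fun i j hij => hmono.injective (congrArg ϱ hij)
  -- The sectors degenerate to single radii. The target is read off the original index σ k, not the
  -- rank k, because density is counted in the original order.
  refine ⟨fun k => ϱ (σ k), fun k => ϱ (σ k), fun k => padicValNat 2 (σ k), hσ0, fun k => le_rfl,
    fun k => hmono (Nat.lt_succ_self k), fun k => (ϱ (σ k)).2.2,
    hϱ.comp hσinj.nat_tendsto_atTop, fun p s₀ hs₀ => ?_⟩
  obtain ⟨N, hN⟩ :=
    (hϱ.eventually (lt_mem_nhds (max_lt hR1 hs₀))).exists_forall_of_atTop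
  -- Indices of valuation p have density 1/2^(p+1); half of it absorbs the finitely many discarded
  -- indices and the rounding.
  refine ⟨1 / 2 ^ (p + 2), by positivity, ?_⟩
  filter_upwards [eventually_ge_atTop 1, (tendsto_const_div_atTop_nhds_zero_nat
    ((N : ℝ) + 1)).eventually (gt_mem_nhds (by positivity : (0 : ℝ) < 1 / 2 ^ (p + 2)))]
    with n hn hns
  have hn0 : (0 : ℝ) < n := by exact_mod_cast hn
  rw [seqMeasure_real]
  set M := n / 2 ^ (p + 1) with hM
  have hMn : 2 ^ (p + 1) * M ≤ n := Nat.mul_div_le _ _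
  have hnM : n < 2 ^ (p + 1) * (M + 1) := Nat.lt_mul_div_succ n (by positivity)
  have hsub : (((Finset.Ico N M).image fun i => 2 ^ p * (2 * i + 1) : Finset ℕ) : Set ℕ) ⊆
      (ϱ ⁻¹' {r | s₀ ≤ (r : ℝ) ∧ ∃ k, padicValNat 2 (σ k) = p ∧
        (r : ℝ) ∈ Icc (ϱ (σ k) : ℝ) (ϱ (σ k))} ∩ Icc 1 n : Set ℕ) := by
    intro j hj
    simp only [Finset.coe_image, mem_image, Finset.coe_Ico, mem_Ico] at hj
    obtain ⟨i, ⟨hi1, hi2⟩, rfl⟩ := hj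
    have h2 : 1 ≤ 2 ^ p := Nat.one_le_two_pow
    have hjN : 2 * i + 1 ≤ 2 ^ p * (2 * i + 1) := Nat.le_mul_of_pos_left _ h2
    have hjn : 2 ^ p * (2 * i + 1) ≤ n := by
      calc 2 ^ p * (2 * i + 1) ≤ 2 ^ p * (2 * M) := Nat.mul_le_mul_left _ (by omega)
        _ = 2 ^ (p + 1) * M := by ring
        _ ≤ n := hMn
    have h3 := hN (2 ^ p * (2 * i + 1)) (by omega)
    obtain ⟨k, hk⟩ := hσ _ ((le_max_left _ _).trans_lt h3)
    refine ⟨⟨((le_max_right _ _).trans_lt h3).le, k, ?_, ?_⟩, by omega, hjn⟩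
    · rw [hk, padicValNat_two_pow_mul_odd]
    · rw [hk]; exact ⟨le_rfl, le_rfl⟩
  have hcard := ncard_le_ncard hsub ((finite_Icc 1 n).subset inter_subset_right)
  rw [ncard_coe_finset, Finset.card_image_of_injective _ (fun i j hij => by
    have := Nat.eq_of_mul_eq_mul_left (by positivity : 0 < 2 ^ p) hij
    omega), Nat.card_Ico] at hcard
  have hcard' : (M : ℝ) - N ≤ ((ϱ ⁻¹' {r | s₀ ≤ (r : ℝ) ∧ ∃ k, padicValNat 2 (σ k) = p ∧
        (r : ℝ) ∈ Icc (ϱ (σ k) : ℝ) (ϱ (σ k))} ∩ Icc 1 n : Set ℕ).ncard : ℝ) := by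
    have h4 : M ≤ (M - N) + N := by omega
    have h5 : (M : ℝ) ≤ ((M - N : ℕ) : ℝ) + N := by exact_mod_cast h4
    have h6 : ((M - N : ℕ) : ℝ) ≤ _ := Nat.cast_le.2 hcard
    linarith
  rw [le_div_iff₀ hn0]
  refine le_trans ?_ hcard'
  have h7 : (n : ℝ) < 2 ^ (p + 1) * (M + 1) := by exact_mod_cast hnM
  have h8 : (n : ℝ) / 2 ^ (p + 1) < M + 1 := by rw [div_lt_iff₀ (by positivity)]; linarith
  rw [div_lt_iff₀ hn0] at hns
  have h9 : (n : ℝ) / 2 ^ (p + 1) = 1 / 2 ^ (p + 2) * n + 1 / 2 ^ (p + 2) * n := by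
    rw [pow_succ _ (p + 1)]; field_simp; norm_num
  linarith

end AbelUniversal

theorem corollary6p6
    (𝒱 : (K : Set Circle) → Set (Set C(K, ℂ))) (h𝒱 : AbelUniversal.IsBaseChoice 𝒱)
    (ϱ : ℕ → Ico (0 : ℝ) 1) (hϱ : Tendsto (fun n => (ϱ n : ℝ)) atTop (𝓝 1)) :
    (AbelUniversal.UpperFUAlong 𝒱 ϱ ∈ residual AbelUniversal.HolDisc ∧
      AbelUniversal.UpperFU 𝒱 ∈ residual AbelUniversal.HolDisc) ∧
    (Dense (AbelUniversal.UpperOneFUAlong 𝒱 ϱ) ∧ IsGδ (AbelUniversal.UpperOneFUAlong 𝒱 ϱ)) ∧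
    (Dense (AbelUniversal.UpperOneFU 𝒱) ∧ IsGδ (AbelUniversal.UpperOneFU 𝒱)) ∧
    ((Function.Injective ϱ → Dense (AbelUniversal.FUAlong 𝒱 ϱ)) ∧
      IsMeagre (AbelUniversal.FUAlong 𝒱 ϱ)) ∧
    (Dense (AbelUniversal.FU 𝒱) ∧ IsMeagre (AbelUniversal.FU 𝒱)) := by
  open AbelUniversal in
  have hseq1 := tendsto_real_univ (μ := seqMeasure ϱ) fun n hn => seqMeasure_univ ϱ hn
  have hrad1 := tendsto_real_univ (μ := radMeasure) fun n hn => radMeasure_univ hn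
  have hd1 : Dense (UpperOneFUAlong 𝒱 ϱ) := by
    rw [upperOneFUAlong_eq]
    exact dense_classOf_upperOne h𝒱 hseq1 fun t ht => seqMeasure_tendsto hϱ ht
  have hg1 : IsGδ (UpperOneFUAlong 𝒱 ϱ) := by
    rw [upperOneFUAlong_eq]
    exact isGδ_classOf_upperOne h𝒱
  have hd2 : Dense (UpperOneFU 𝒱) := by
    rw [upperOneFU_eq h𝒱]
    exact dense_classOf_upperOne h𝒱 hrad1 fun t ht => radMeasure_tendsto ht
  have hg2 : IsGδ (UpperOneFU 𝒱) := by
    rw [upperOneFU_eq h𝒱]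
    exact isGδ_classOf_upperOne h𝒱
  refine ⟨⟨?_, ?_⟩, ⟨hd1, hg1⟩, ⟨hd2, hg2⟩, ⟨fun hinj => ?_, ?_⟩, ?_, ?_⟩
  · refine mem_of_superset (residual_of_dense_Gδ hg1 hd1) fun f hf K hK hK' V hV => ?_
    rw [hf K hK hK' V hV]
    exact one_pos
  · refine mem_of_superset (residual_of_dense_Gδ hg2 hd2) fun f hf K hK hK' V hV => ?_
    rw [hf K hK hK' V hV]
    exact one_pos
  · rw [fuAlong_eq]
    exact dense_fuAlong h𝒱 hϱ hinj
  · rw [fuAlong_eq]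
    exact isMeagre_classOf_lowerPos h𝒱 hseq1 (fun n => seqMeasure_le_one ϱ n _)
      fun t ht => seqMeasure_tendsto hϱ ht
  · rw [fu_eq]
    exact dense_fu h𝒱
  · rw [fu_eq]
    exact isMeagre_classOf_lowerPos h𝒱 hrad1 (fun n => radMeasure_le_one n _)
      fun t ht => radMeasure_tendsto ht
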